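/- Let $K$ be a field of characteristic $0$, let $V_1$ be the $SL_2$-module of binary linear forms over $K$ (with $SL_2=SL_2(K)$ acting by linear substitution), and let $\mathcal I=K[6V_1]^{SL_2}$ be the algebra of $SL_2$-invariant polynomial functions on $6V_1=V_1^{\oplus 6}$, graded by polynomial degree. Then $\mathcal I$ has a finite minimal generating set consisting of homogeneous elements. Let $f_1,\dots,f_m$ be any such set, let $R=K[x_1,\dots,x_m]$ be graded by $\deg x_i=\deg f_i$, and regard $\mathcal I$ as a graded $R$-module through $R\to\mathcal I$, $x_i\mapsto f_i$. Then $\mathcal I$ has a minimal graded free resolution over $R$ of the form $$0\to R(-18)\to R(-14)^{15}\to R(-12)^{35}\to R(-8)^{21}\oplus R(-10)^{21}\to R(-6)^{35}\to R(-4)^{15}\to R\to\mathcal I\to 0,$$ in which $R\to\mathcal I$ is the map above; that is, the sequence is exact, all maps are $R$-linear and homogeneous of degree $0$, and the image of each map between free modules lies in $(x_1,\dots,x_m)$ times its target. This resolution has length $6$, and the homological (projective) dimension of $\mathcal I$ as an $R$-module is $6$. -/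

import Mathlib

open MvPolynomial

universe u

/-- The `SL₂`-module `V_d` of binary forms of degree `d` over `K`. -/
abbrev BinaryForm (K : Type u) [Field K] (d : ℕ) : Type u :=
  homogeneousSubmodule (Fin 2) K d

/-- The action of `SL₂` on binary forms by linear substitution: `(g • p)(x) = p(g⁻¹ x)`. -/
noncomputable def BinaryForm.act {K : Type u} [Field K] {d : ℕ}
    (g : Matrix.SpecialLinearGroup (Fin 2) K) (p : BinaryForm K d) : BinaryForm K d :=
  ⟨aeval (fun i : Fin 2 => ∑ j : Fin 2, C (g⁻¹ i j) * X j) (p : MvPolynomial (Fin 2) K), by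
    rw [mem_homogeneousSubmodule]
    have h := ((mem_homogeneousSubmodule d _).1 p.2).aeval
      (fun i : Fin 2 => ∑ j : Fin 2, C (g⁻¹ i j) * (X j : MvPolynomial (Fin 2) K)) (n := 1)
      (fun i => IsHomogeneous.sum _ _ _ fun j _ => isHomogeneous_C_mul_X _ _)
    simpa using h⟩

/-- Linear coordinates on `n V₁ = V₁ ⊕ ⋯ ⊕ V₁`: the coordinate `(i, j)` of `(ℓ₁, …, ℓₙ)` is the
coefficient of the variable `X j` in the `i`-th linear form. -/
noncomputable def linearFormsCoord {K : Type u} [Field K] {n : ℕ} (v : Fin n → BinaryForm K 1) :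
    Fin n × Fin 2 → K :=
  fun a => coeff (Finsupp.single a.2 1) (v a.1 : MvPolynomial (Fin 2) K)

/-- The algebra `K[n V₁]^{SL₂}`: the polynomial functions on `n V₁` (polynomials in the linear
coordinates) that are constant on the `SL₂`-orbits. -/
noncomputable def linearFormsInvariants (K : Type u) [Field K] (n : ℕ) :
    Subalgebra K (MvPolynomial (Fin n × Fin 2) K) where
  carrier := {f | ∀ (g : Matrix.SpecialLinearGroup (Fin 2) K) (v : Fin n → BinaryForm K 1),
    eval (linearFormsCoord fun i => BinaryForm.act g (v i)) f = eval (linearFormsCoord v) f}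
  mul_mem' := by
    intro a b ha hb g v
    rw [map_mul, map_mul, ha g v, hb g v]
  add_mem' := by
    intro a b ha hb g v
    rw [map_add, map_add, ha g v, hb g v]
  algebraMap_mem' := by
    intro r g v
    simp [algebraMap_eq]

/-- The family `f` of elements of a subalgebra `A` of a polynomial ring is a minimal generating
set of `A` consisting of homogeneous elements, `f i` being of degree `w i`. -/
structure IsMinimalHomogeneousGenerators {K : Type u} [Field K] {τ : Type}
    (A : Subalgebra K (MvPolynomial τ K)) {m : ℕ} (w : Fin m → ℕ) (f : Fin m → A) : Prop where
  homogeneous : ∀ i, (f i : MvPolynomial τ K).IsHomogeneous (w i)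
  generates : Algebra.adjoin K (Set.range f) = ⊤
  minimal : ∀ S : Set (Fin m), Algebra.adjoin K (f '' S) = ⊤ → S = Set.univ

/-- For `R = K[x_i : i ∈ σ]` and a list `e = [e₁, …, e_r]`, the free module
`R(-e₁) ⊕ ⋯ ⊕ R(-e_r)`. -/
abbrev ShiftedFree (K : Type u) [Field K] (σ : Type) (e : List ℕ) : Type u :=
  Fin e.length → MvPolynomial σ K

/-- The graded piece of degree `n` of `R(-e₁) ⊕ ⋯ ⊕ R(-e_r)`, where `x_i` has degree `w i`: every
monomial occurring in the `a`-th entry has weighted degree `n - e_a`. -/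
def IsDegree {K : Type u} [Field K] {σ : Type} (w : σ → ℕ) {e : List ℕ} (n : ℕ)
    (v : ShiftedFree K σ e) : Prop :=
  ∀ a : Fin e.length, ∀ s : σ →₀ ℕ, coeff s (v a) ≠ 0 → Finsupp.weight w s + e.get a = n

/-- A minimal graded free resolution `⋯ → F₂ → F₁ → F₀ → A → 0`, over `R = K[x_i : i ∈ σ]` graded
by `deg x_i = w i`, of a graded subalgebra `A` of a polynomial ring, which is an `R`-module through
`φ : R → A`. The module `F i` is the direct sum of the `R(-j)`, `j` running over the list `e i`. -/
structure MinimalGradedFreeResolution {K : Type u} [Field K] {σ τ : Type} (w : σ → ℕ)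
    (A : Subalgebra K (MvPolynomial τ K)) (φ : MvPolynomial σ K →ₐ[K] A) (e : ℕ → List ℕ) where
  /-- the differentials -/
  d : ∀ i, ShiftedFree K σ (e (i + 1)) →ₗ[MvPolynomial σ K] ShiftedFree K σ (e i)
  /-- the augmentation -/
  ε : ShiftedFree K σ (e 0) →ₛₗ[(φ : MvPolynomial σ K →+* A)] A
  d_graded : ∀ i n v, IsDegree w n v → IsDegree w n (d i v)
  ε_graded : ∀ n v, IsDegree w n v → (ε v : MvPolynomial τ K).IsHomogeneous n
  ε_surjective : Function.Surjective ε
  exact_zero : Function.Exact (d 0) ε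
  exact_succ : ∀ i, Function.Exact (d (i + 1)) (d i)
  minimal : ∀ i, LinearMap.range (d i) ≤
    Ideal.span (Set.range (X : σ → MvPolynomial σ K)) •
      (⊤ : Submodule (MvPolynomial σ K) (ShiftedFree K σ (e i)))

/-- The projective (homological) dimension of `A` as a module over `R` through `φ : R → A`. -/
noncomputable def homologicalDimension {R A : Type u} [CommRing R] [CommRing A] (φ : R →+* A) :
    WithBot ℕ∞ :=
  letI : Module R A := Module.compHom A φ
  CategoryTheory.projectiveDimension (ModuleCat.of R A)

/-- The shifts of the complex
`0 → R(-18) → R(-14)^15 → R(-12)^35 → R(-8)^21 ⊕ R(-10)^21 → R(-6)^35 → R(-4)^15 → R`. -/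
def sixLinearFormsShifts : ℕ → List ℕ
  | 0 => [0]
  | 1 => List.replicate 15 4
  | 2 => List.replicate 35 6
  | 3 => List.replicate 21 8 ++ List.replicate 21 10
  | 4 => List.replicate 35 12
  | 5 => List.replicate 15 14
  | 6 => [18]
  | _ => []

/-!
By the first and second fundamental theorems for `SL₂`, the algebra of invariants is generated by
the `15` brackets of pairs of linear forms, and the ideal of relations between them is generated by
the Pfaffians of order `4` of the generic skew-symmetric `6 × 6` matrix. Both theorems reduce to the
open set where the first bracket does not vanish: there a unimodular substitution normalizes two of
the forms and makes the coordinates of the others rational in the brackets, and the first bracket is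
a nonzerodivisor modulo the Pfaffians.

The ideal is resolved by the complex of Józefiak and Pragacz, of length six, whose differentials
multiply by the matrix and by its Pfaffian adjoint. Every element of the ideal acts on the complex
by a map homotopic to zero, so the complex is exact as soon as the ideal contains a regular sequence
of length six. Such a sequence comes from a linear section in six variables for which the quotient
is integral over the constants.

Any other minimal set of homogeneous generators differs from the brackets by an invertible linear
substitution. The resolution is minimal because consecutive terms have no shift in common, so that
no entry of a differential is a nonzero constant, and minimality shows that no shorter resolution
exists.
-/

open Matrix

/-! ## The Pfaffian complex of a skew-symmetric matrix -/

section PfaffianAdjoint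

variable {S : Type*} [CommRing S]

/-- The skew-symmetric `6 × 6` matrix with given entries above the diagonal, row by row. -/
def skewMatrix : (Fin 15 → S) →ₗ[S] Matrix (Fin 6) (Fin 6) S where
  toFun x := !![0, x 0, x 1, x 2, x 3, x 4;
    -x 0, 0, x 5, x 6, x 7, x 8;
    -x 1, -x 5, 0, x 9, x 10, x 11;
    -x 2, -x 6, -x 9, 0, x 12, x 13;
    -x 3, -x 7, -x 10, -x 12, 0, x 14;
    -x 4, -x 8, -x 11, -x 13, -x 14, 0]
  map_add' x y := by ext i j; fin_cases i <;> fin_cases j <;> simp [add_comm]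
  map_smul' r x := by ext i j; fin_cases i <;> fin_cases j <;> simp

theorem skewMatrix_apply (x : Fin 15 → S) : skewMatrix x =
    !![0, x 0, x 1, x 2, x 3, x 4;
      -x 0, 0, x 5, x 6, x 7, x 8;
      -x 1, -x 5, 0, x 9, x 10, x 11;
      -x 2, -x 6, -x 9, 0, x 12, x 13;
      -x 3, -x 7, -x 10, -x 12, 0, x 14;
      -x 4, -x 8, -x 11, -x 13, -x 14, 0] := rfl

/-- The entries of a `6 × 6` matrix above the diagonal, row by row. -/
def upperEntries : Matrix (Fin 6) (Fin 6) S →ₗ[S] (Fin 15 → S) where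
  toFun Z := ![Z 0 1, Z 0 2, Z 0 3, Z 0 4, Z 0 5, Z 1 2, Z 1 3, Z 1 4, Z 1 5, Z 2 3, Z 2 4, Z 2 5,
    Z 3 4, Z 3 5, Z 4 5]
  map_add' Z W := by funext k; fin_cases k <;> rfl
  map_smul' r Z := by funext k; fin_cases k <;> rfl

theorem upperEntries_skewMatrix (x : Fin 15 → S) : upperEntries (skewMatrix x) = x := by
  funext k; fin_cases k <;> rfl

theorem skewMatrix_transpose (x : Fin 15 → S) : (skewMatrix x)ᵀ = -skewMatrix x := by
  ext i j; fin_cases i <;> fin_cases j <;> simp [skewMatrix_apply]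

theorem skewMatrix_upperEntries (h2 : IsUnit (2 : S)) {Z : Matrix (Fin 6) (Fin 6) S}
    (hZ : Zᵀ = -Z) : skewMatrix (upperEntries Z) = Z := by
  have h : ∀ i j, -Z i j = Z j i := fun i j => (congrFun (congrFun hZ i) j).symm
  have h0 : ∀ i, 0 = Z i i := fun i => by
    have : 2 * Z i i = 0 := by linear_combination -h i i
    exact (h2.mul_right_eq_zero.1 this).symm
  ext i j
  fin_cases i <;> fin_cases j <;> first | exact h0 _ | rfl | exact h _ _

/-- The Pfaffian of the principal `4 × 4` block with indices `a, b, c, d`. -/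
def blockPfaffian (X : Matrix (Fin 6) (Fin 6) S) (a b c d : Fin 6) : S :=
  X a b * X c d - X a c * X b d + X a d * X b c

/-- The polarization of `blockPfaffian`, which is quadratic in the matrix. -/
def polarBlockPfaffian (X Z : Matrix (Fin 6) (Fin 6) S) (a b c d : Fin 6) : S :=
  X a b * Z c d + Z a b * X c d - (X a c * Z b d + Z a c * X b d) + (X a d * Z b c + Z a d * X b c)

/-- The skew-symmetric matrix whose entry at `(i, j)`, for `i < j`, is `q a b c d` up to the sign
of the permutation `(j, i, a, b, c, d)`, where `a < b < c < d` are the remaining indices. -/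
def skewComplement (q : Fin 6 → Fin 6 → Fin 6 → Fin 6 → S) : Matrix (Fin 6) (Fin 6) S :=
  skewMatrix ![-q 2 3 4 5, q 1 3 4 5, -q 1 2 4 5, q 1 2 3 5, -q 1 2 3 4,
    -q 0 3 4 5, q 0 2 4 5, -q 0 2 3 5, q 0 2 3 4,
    -q 0 1 4 5, q 0 1 3 5, -q 0 1 3 4,
    -q 0 1 2 5, q 0 1 2 4,
    -q 0 1 2 3]

/-- The Pfaffian adjoint of a skew-symmetric `6 × 6` matrix, the analogue of the adjugate with
Pfaffians in place of determinants. -/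
def pfAdj (X : Matrix (Fin 6) (Fin 6) S) : Matrix (Fin 6) (Fin 6) S :=
  skewComplement (blockPfaffian X)

/-- The polarization of the quadratic map `pfAdj`. -/
def polarAdj (X Z : Matrix (Fin 6) (Fin 6) S) : Matrix (Fin 6) (Fin 6) S :=
  skewComplement (polarBlockPfaffian X Z)

/-- The Pfaffian of a skew-symmetric `6 × 6` matrix. -/
def pfaffian (X : Matrix (Fin 6) (Fin 6) S) : S :=
  X 0 1 * blockPfaffian X 2 3 4 5 - X 0 2 * blockPfaffian X 1 3 4 5
    + X 0 3 * blockPfaffian X 1 2 4 5 - X 0 4 * blockPfaffian X 1 2 3 5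
    + X 0 5 * blockPfaffian X 1 2 3 4

theorem pfAdj_transpose (X : Matrix (Fin 6) (Fin 6) S) : (pfAdj X)ᵀ = -pfAdj X :=
  skewMatrix_transpose _

theorem polarAdj_transpose (X Z : Matrix (Fin 6) (Fin 6) S) : (polarAdj X Z)ᵀ = -polarAdj X Z :=
  skewMatrix_transpose _

theorem skewMatrix_mul_pfAdj (x : Fin 15 → S) :
    skewMatrix x * pfAdj (skewMatrix x) = pfaffian (skewMatrix x) • 1 := by
  ext i j
  fin_cases i <;> fin_cases j <;>
    simp only [Fin.zero_eta, Fin.mk_one, Fin.reduceFinMk, Matrix.smul_apply, Matrix.mul_apply,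
      Fin.sum_univ_six, skewMatrix_apply, pfAdj, skewComplement, blockPfaffian, pfaffian,
      Matrix.of_apply, Matrix.cons_val, Matrix.one_apply, Fin.reduceEq, if_true, if_false,
      smul_eq_mul] <;>
    ring

/-- The derivative at `X`, in the direction of a skew-symmetric matrix `M`, of the Pfaffian. -/
def polarPfaffian (X : Matrix (Fin 6) (Fin 6) S) : Matrix (Fin 6) (Fin 6) S →ₗ[S] S where
  toFun M := -(upperEntries M ⬝ᵥ upperEntries (pfAdj X))
  map_add' M N := by rw [map_add, add_dotProduct, neg_add]
  map_smul' r M := by rw [map_smul, smul_dotProduct, smul_neg, RingHom.id_apply]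

theorem polarPfaffian_skewMatrix (X : Matrix (Fin 6) (Fin 6) S) (c : Fin 15 → S) :
    polarPfaffian X (skewMatrix c) = -(c ⬝ᵥ upperEntries (pfAdj X)) :=
  congrArg (fun y => -(y ⬝ᵥ upperEntries (pfAdj X))) (upperEntries_skewMatrix c)

theorem skewMatrix_mul_polarAdj_add (x z : Fin 15 → S) :
    skewMatrix x * polarAdj (skewMatrix x) (skewMatrix z) + skewMatrix z * pfAdj (skewMatrix x) =
      polarPfaffian (skewMatrix x) (skewMatrix z) • (1 : Matrix (Fin 6) (Fin 6) S) := by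
  rw [polarPfaffian_skewMatrix, pfAdj, skewComplement, upperEntries_skewMatrix]
  ext i j
  fin_cases i <;> fin_cases j <;>
    simp only [Fin.zero_eta, Fin.mk_one, Fin.reduceFinMk, Matrix.smul_apply, Matrix.add_apply,
      Matrix.mul_apply, skewMatrix_apply, polarAdj, skewComplement,
      blockPfaffian, polarBlockPfaffian, dotProduct, Fin.sum_univ_succ, Fin.sum_univ_zero,
      Fin.reduceSucc, Matrix.of_apply, Matrix.cons_val, Matrix.one_apply, Fin.reduceEq, if_true,
      if_false, smul_eq_mul] <;>
    ring

theorem trace_skewMatrix_mul_skewMatrix (x y : Fin 15 → S) :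
    trace (skewMatrix x * skewMatrix y) = -2 * (x ⬝ᵥ y) := by
  simp only [trace, diag_apply, Matrix.mul_apply, skewMatrix_apply, Matrix.of_apply,
    Matrix.cons_val, dotProduct, Fin.sum_univ_succ, Fin.sum_univ_zero,
    Fin.reduceSucc]
  ring

theorem polarBlockPfaffian_infinitesimal (X G : Matrix (Fin 6) (Fin 6) S) (a b c d : Fin 6) :
    polarBlockPfaffian X (G * X + X * Gᵀ) a b c d =
      ∑ l, (G a l * blockPfaffian X l b c d + G b l * blockPfaffian X a l c d
        + G c l * blockPfaffian X a b l d + G d l * blockPfaffian X a b c l) := by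
  simp only [polarBlockPfaffian, blockPfaffian, Matrix.add_apply, Matrix.mul_apply,
    transpose_apply, Finset.mul_sum, Finset.sum_mul, ← Finset.sum_add_distrib,
    ← Finset.sum_sub_distrib]
  exact Finset.sum_congr rfl fun l _ => by ring

theorem polarAdj_skewMatrix_infinitesimal (x : Fin 15 → S) (G : Matrix (Fin 6) (Fin 6) S) :
    polarAdj (skewMatrix x) (G * skewMatrix x + skewMatrix x * Gᵀ) =
      trace G • pfAdj (skewMatrix x) - Gᵀ * pfAdj (skewMatrix x) - pfAdj (skewMatrix x) * G := by
  ext i j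
  fin_cases i <;> fin_cases j <;>
    simp only [Fin.zero_eta, Fin.mk_one, Fin.reduceFinMk, polarAdj, pfAdj, skewComplement,
      skewMatrix_apply (![_, _, _, _, _, _, _, _, _, _, _, _, _, _, _] : Fin 15 → S),
      polarBlockPfaffian_infinitesimal, trace, Matrix.smul_apply, Matrix.sub_apply,
      Matrix.mul_apply, Matrix.diag_apply, Fin.sum_univ_six, Matrix.transpose_apply, smul_eq_mul,
      Matrix.of_apply, Matrix.cons_val] <;>
    simp only [blockPfaffian, skewMatrix_apply, Matrix.of_apply, Matrix.cons_val] <;>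
    ring

theorem trace_polarAdj_skewMatrix_comm (x z c : Fin 15 → S) :
    trace (polarAdj (skewMatrix x) (skewMatrix z) * skewMatrix c) =
      trace (polarAdj (skewMatrix x) (skewMatrix c) * skewMatrix z) := by
  simp only [trace, Matrix.mul_apply, Matrix.diag_apply, Fin.sum_univ_six, skewMatrix_apply,
    polarAdj, skewComplement, polarBlockPfaffian, Matrix.of_apply, Matrix.cons_val]
  ring

variable {X M C : Matrix (Fin 6) (Fin 6) S}

theorem mul_pfAdj (h2 : IsUnit (2 : S)) (hX : Xᵀ = -X) : X * pfAdj X = pfaffian X • 1 := by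
  rw [← skewMatrix_upperEntries h2 hX, skewMatrix_mul_pfAdj]

theorem pfAdj_mul (h2 : IsUnit (2 : S)) (hX : Xᵀ = -X) : pfAdj X * X = pfaffian X • 1 := by
  have h := congrArg transpose (mul_pfAdj h2 hX)
  simpa [transpose_mul, hX, pfAdj_transpose] using h

theorem mul_polarAdj_add (h2 : IsUnit (2 : S)) (hX : Xᵀ = -X) (hM : Mᵀ = -M) :
    X * polarAdj X M + M * pfAdj X = polarPfaffian X M • 1 := by
  rw [← skewMatrix_upperEntries h2 hX, ← skewMatrix_upperEntries h2 hM,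
    skewMatrix_mul_polarAdj_add]

theorem polarAdj_mul_add (h2 : IsUnit (2 : S)) (hX : Xᵀ = -X) (hM : Mᵀ = -M) :
    polarAdj X M * X + pfAdj X * M = polarPfaffian X M • 1 := by
  have h := congrArg transpose (mul_polarAdj_add h2 hX hM)
  simpa [transpose_mul, hX, hM, pfAdj_transpose, polarAdj_transpose, add_comm] using h

theorem trace_mul_pfAdj (h2 : IsUnit (2 : S)) (hM : Mᵀ = -M) :
    trace (M * pfAdj X) = 2 * polarPfaffian X M := by
  rw [← skewMatrix_upperEntries h2 hM, polarPfaffian_skewMatrix, pfAdj, skewComplement,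
    trace_skewMatrix_mul_skewMatrix, upperEntries_skewMatrix]
  ring

theorem polarAdj_infinitesimal (h2 : IsUnit (2 : S)) (hX : Xᵀ = -X)
    (G : Matrix (Fin 6) (Fin 6) S) :
    polarAdj X (G * X + X * Gᵀ) = trace G • pfAdj X - Gᵀ * pfAdj X - pfAdj X * G := by
  rw [← skewMatrix_upperEntries h2 hX, polarAdj_skewMatrix_infinitesimal]

theorem trace_polarAdj_mul_comm (h2 : IsUnit (2 : S)) (hX : Xᵀ = -X) (hM : Mᵀ = -M)
    (hC : Cᵀ = -C) : trace (polarAdj X M * C) = trace (polarAdj X C * M) := by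
  rw [← skewMatrix_upperEntries h2 hX, ← skewMatrix_upperEntries h2 hM,
    ← skewMatrix_upperEntries h2 hC, trace_polarAdj_skewMatrix_comm]

theorem skewComplement_smul (r : S) (q : Fin 6 → Fin 6 → Fin 6 → Fin 6 → S) :
    skewComplement (r • q) = r • skewComplement q := by
  rw [skewComplement, skewComplement, ← map_smul]
  congr 1
  simp only [Pi.smul_apply, Matrix.smul_cons, smul_neg, Matrix.smul_empty]

theorem polarAdj_smul (X M : Matrix (Fin 6) (Fin 6) S) (r : S) :
    polarAdj X (r • M) = r • polarAdj X M := by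
  rw [polarAdj, polarAdj, ← skewComplement_smul]
  congr 1
  ext a b c d
  simp only [polarBlockPfaffian, Matrix.smul_apply, Pi.smul_apply, smul_eq_mul]
  ring

end PfaffianAdjoint

section Homotopy

variable {S : Type*} [CommRing S] {X M : Matrix (Fin 6) (Fin 6) S}

theorem skew_homotopy {C : Matrix (Fin 6) (Fin 6) S} (h2 : IsUnit (2 : S)) (hX : Xᵀ = -X)
    (hM : Mᵀ = -M) (hC : Cᵀ = -C) {A : Matrix (Fin 6) (Fin 6) S}
    (hA : A = C * polarAdj X M - M * polarAdj X C) :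
    trace A = 0 ∧ A * X + X * Aᵀ =
      (2 * polarPfaffian X M) • C - (2 * polarPfaffian X C) • M := by
  subst hA
  constructor
  · rw [trace_sub, trace_mul_comm C, trace_mul_comm M, trace_polarAdj_mul_comm h2 hX hM hC,
      sub_self]
  · have e1 := congrArg (C * ·) (polarAdj_mul_add h2 hX hM)
    have e2 := congrArg (· * C) (mul_polarAdj_add h2 hX hM)
    have e3 := congrArg (M * ·) (polarAdj_mul_add h2 hX hC)
    have e4 := congrArg (· * M) (mul_polarAdj_add h2 hX hC)
    simp only [transpose_sub, transpose_mul, hM, hC, polarAdj_transpose, mul_add, add_mul, mul_sub,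
      sub_mul, mul_neg, neg_mul, neg_neg, mul_assoc, smul_mul_assoc, mul_smul_comm, mul_one,
      one_mul, add_smul, two_mul] at e1 e2 e3 e4 ⊢
    linear_combination (norm := module) e1 + e2 - e3 - e4

theorem traceless_homotopy {A : Matrix (Fin 6) (Fin 6) S} (h2 : IsUnit (2 : S)) (hX : Xᵀ = -X)
    (hM : Mᵀ = -M) (hA : trace A = 0) (hdA : A * X + X * Aᵀ = 0) :
    X * (polarAdj X M * A - Aᵀ * polarAdj X M) + (A * M - M * Aᵀ) * pfAdj X =
      (2 * polarPfaffian X M) • A := by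
  have hpolar : 0 = -(Aᵀ * pfAdj X) - pfAdj X * A := by
    have h := polarAdj_infinitesimal h2 hX A
    rwa [hdA, hA, zero_smul, zero_sub, ← zero_smul S 0, polarAdj_smul, zero_smul] at h
  have e1 := congrArg (A * ·) (mul_polarAdj_add h2 hX hM)
  have e2 := congrArg (· * A) (mul_polarAdj_add h2 hX hM)
  have e3 := congrArg (M * ·) hpolar
  have e4 := congrArg (· * polarAdj X M) hdA
  simp only [mul_add, add_mul, mul_sub, sub_mul, mul_neg, mul_assoc, smul_mul_assoc,
    mul_smul_comm, mul_one, one_mul, add_smul, two_mul, mul_zero, zero_mul] at e1 e2 e3 e4 ⊢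
  linear_combination (norm := module) e1 + e2 - e3 - e4

theorem symm_homotopy {P T : Matrix (Fin 6) (Fin 6) S} (h2 : IsUnit (2 : S)) (hX : Xᵀ = -X)
    (hM : Mᵀ = -M) (hP : Pᵀ = P) (hT : Tᵀ = T) (hd : X * P + T * pfAdj X = 0)
    {B : Matrix (Fin 6) (Fin 6) S} (hB : B = polarAdj X M * T - P * M) :
    pfAdj X * Bᵀ - B * pfAdj X = (2 * polarPfaffian X M) • P ∧
      X * B - Bᵀ * X = (2 * polarPfaffian X M) • T := by
  have hd' : P * X + pfAdj X * T = 0 := by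
    have h := congrArg transpose hd
    simp only [transpose_add, transpose_mul, hP, hT, hX, pfAdj_transpose, transpose_zero, mul_neg,
      neg_mul, ← neg_add] at h
    exact neg_eq_zero.1 h
  subst hB
  have h1 := mul_polarAdj_add h2 hX hM
  have h1' := polarAdj_mul_add h2 hX hM
  have e1 := congrArg (polarAdj X M * ·) hd
  have e2 := congrArg (· * polarAdj X M) hd'
  have e3 := congrArg (· * P) h1'
  have e4 := congrArg (P * ·) h1
  have f1 := congrArg (· * M) hd
  have f2 := congrArg (M * ·) hd'
  have f3 := congrArg (· * T) h1
  have f4 := congrArg (T * ·) h1'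
  simp only [transpose_sub, transpose_mul, hP, hT, hM, polarAdj_transpose, mul_add, add_mul,
    mul_sub, sub_mul, mul_neg, neg_mul, mul_assoc, smul_mul_assoc, mul_smul_comm, mul_one,
    one_mul, add_smul, two_mul, mul_zero, zero_mul] at e1 e2 e3 e4 f1 f2 f3 f4 ⊢
  exact ⟨by linear_combination (norm := module) e3 + e4 - e1 - e2,
    by linear_combination (norm := module) f3 + f4 - f1 - f2⟩

/-- The component, on matrices modulo scalar matrices, of the null-homotopy for multiplication by
`2 * polarPfaffian X M` on the Pfaffian complex. -/
def modScalarsHomotopy (X M B : Matrix (Fin 6) (Fin 6) S) : Matrix (Fin 6) (Fin 6) S :=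
  B * polarAdj X M + polarAdj X M * Bᵀ - polarAdj X (Bᵀ * M + M * B)

theorem modScalarsHomotopy_transpose (B : Matrix (Fin 6) (Fin 6) S) :
    (modScalarsHomotopy X M B)ᵀ = -modScalarsHomotopy X M B := by
  simp only [modScalarsHomotopy, transpose_sub, transpose_add, transpose_mul, polarAdj_transpose,
    transpose_transpose, mul_neg, neg_mul]
  abel

theorem modScalarsHomotopy_smul_one (r : S) : modScalarsHomotopy X M (r • 1) = 0 := by
  simp [modScalarsHomotopy, ← add_smul, polarAdj_smul]

theorem exists_modScalarsHomotopy_mul_eq {B : Matrix (Fin 6) (Fin 6) S} (h2 : IsUnit (2 : S))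
    (hX : Xᵀ = -X) (hM : Mᵀ = -M) (hP : pfAdj X * Bᵀ - B * pfAdj X = 0)
    (hT : X * B - Bᵀ * X = 0) :
    ∃ r : S, modScalarsHomotopy X M B * X = (2 * polarPfaffian X M) • B + r • 1 := by
  have hZ : (Bᵀ * M + M * B)ᵀ = -(Bᵀ * M + M * B) := by
    simp [transpose_mul, hM, add_comm]
  refine ⟨-polarPfaffian X (Bᵀ * M + M * B), ?_⟩
  have hpolar := polarAdj_mul_add h2 hX hZ
  have e1 := congrArg (polarAdj X M * ·) hT
  have e2 := congrArg (· * M) hP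
  have e3 := congrArg (· * B) (polarAdj_mul_add h2 hX hM)
  have e4 := congrArg (B * ·) (polarAdj_mul_add h2 hX hM)
  rw [modScalarsHomotopy]
  simp only [mul_add, add_mul, mul_sub, sub_mul, mul_assoc, smul_mul_assoc, mul_smul_comm, mul_one,
    one_mul, add_smul, neg_smul, two_mul, mul_zero, zero_mul] at e1 e2 e3 e4 hpolar ⊢
  linear_combination (norm := module) e3 + e4 - e1 + e2 - hpolar

theorem skew_homotopy_of_mul_eq_scalar {C : Matrix (Fin 6) (Fin 6) S} (h2 : IsUnit (2 : S))
    (hX : Xᵀ = -X) (hM : Mᵀ = -M) (hC : Cᵀ = -C) {r : S} (hCX : C * X = r • 1) :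
    trace (M * C) • pfAdj X = (2 * polarPfaffian X M) • C := by
  have hT : (C * X)ᵀ = X * C := by simp [transpose_mul, hC, hX]
  have hT' : (M * C)ᵀ = C * M := by simp [transpose_mul, hC, hM]
  have h0 : modScalarsHomotopy X M (C * X) = 0 := by rw [hCX, modScalarsHomotopy_smul_one]
  have hinf : polarAdj X (X * C * M + M * (C * X)) =
      trace (M * C) • pfAdj X - C * M * pfAdj X - pfAdj X * (M * C) := by
    rw [← hT', ← polarAdj_infinitesimal h2 hX, hT', add_comm, mul_assoc, mul_assoc]
  rw [modScalarsHomotopy, hT, hinf] at h0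
  have e3 := congrArg (· * C) (polarAdj_mul_add h2 hX hM)
  have e4 := congrArg (C * ·) (mul_polarAdj_add h2 hX hM)
  simp only [mul_add, add_mul, mul_assoc, smul_mul_assoc, mul_smul_comm, mul_one, one_mul,
    add_smul, two_mul] at e3 e4 h0 ⊢
  linear_combination (norm := module) e3 + e4 - h0

end Homotopy

section Complex

/-- The positions of a `6 × 6` matrix other than the last one. -/
abbrev NonCorner : Type := {p : Fin 6 × Fin 6 // p ≠ (5, 5)}

/-- The index sets of bases of the terms of the Pfaffian complex. These terms are the scalars, the
skew-symmetric matrices, the traceless matrices, the pairs of symmetric matrices, the matrices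
modulo scalar matrices, the skew-symmetric matrices and the scalars. -/
def PfTerm : ℕ → Type
  | 0 => Unit
  | 1 => Fin 15
  | 2 => NonCorner
  | 3 => Sym2 (Fin 6) ⊕ Sym2 (Fin 6)
  | 4 => NonCorner
  | 5 => Fin 15
  | 6 => Unit
  | _ => Empty

variable {S : Type*} [CommRing S]

/-- The matrix with given entries at the positions other than the last one, and zero there. -/
def zeroCornerMatrix : (NonCorner → S) →ₗ[S] Matrix (Fin 6) (Fin 6) S where
  toFun a := Matrix.of fun i j => if h : (i, j) = (5, 5) then 0 else a ⟨(i, j), h⟩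
  map_add' a b := by
    ext i j
    simp only [Matrix.of_apply, Matrix.add_apply]
    split_ifs <;> simp
  map_smul' r a := by
    ext i j
    simp only [Matrix.of_apply, Matrix.smul_apply]
    split_ifs <;> simp

/-- The traceless matrix with given entries at the positions other than the last one. -/
def tracelessMatrix : (NonCorner → S) →ₗ[S] Matrix (Fin 6) (Fin 6) S :=
  zeroCornerMatrix - Matrix.singleLinearMap S 5 5 ∘ₗ traceLinearMap (Fin 6) S S ∘ₗ zeroCornerMatrix

/-- The entries of a matrix at the positions other than the last one. -/
def offCorner : Matrix (Fin 6) (Fin 6) S →ₗ[S] (NonCorner → S) where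
  toFun Z p := Z p.1.1 p.1.2
  map_add' _ _ := rfl
  map_smul' _ _ := rfl

/-- The representative of a matrix modulo scalar matrices whose last entry is zero. -/
def modScalars : Matrix (Fin 6) (Fin 6) S →ₗ[S] Matrix (Fin 6) (Fin 6) S where
  toFun Z := Z - Z 5 5 • 1
  map_add' Z W := by rw [Matrix.add_apply, add_smul, add_sub_add_comm]
  map_smul' r Z := by rw [Matrix.smul_apply, smul_eq_mul, mul_smul, RingHom.id_apply, smul_sub]

/-- The symmetric matrix with given entries. -/
def symmMatrix : (Sym2 (Fin 6) → S) →ₗ[S] Matrix (Fin 6) (Fin 6) S where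
  toFun a := Matrix.of fun i j => a s(i, j)
  map_add' _ _ := rfl
  map_smul' _ _ := rfl

/-- The entries of a symmetric matrix; of a general matrix, an arbitrary choice of one entry from
each pair of transposed positions. -/
noncomputable def symmEntries : Matrix (Fin 6) (Fin 6) S →ₗ[S] (Sym2 (Fin 6) → S) where
  toFun Z p := Z p.out.1 p.out.2
  map_add' _ _ := rfl
  map_smul' _ _ := rfl

theorem offCorner_zeroCornerMatrix (a : NonCorner → S) : offCorner (zeroCornerMatrix a) = a := by
  funext p
  exact dif_neg p.2

theorem zeroCornerMatrix_offCorner (Z : Matrix (Fin 6) (Fin 6) S) :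
    zeroCornerMatrix (offCorner Z) = Z - single 5 5 (Z 5 5) := by
  ext i j
  change (if _ : (i, j) = (5, 5) then 0 else Z i j) = Z i j - single 5 5 (Z 5 5) i j
  split_ifs with h
  · obtain ⟨rfl, rfl⟩ := Prod.mk.inj h
    rw [single_apply_same, sub_self]
  · rw [single_apply_of_ne, sub_zero]
    rintro ⟨rfl, rfl⟩
    exact h rfl

theorem tracelessMatrix_apply (a : NonCorner → S) : tracelessMatrix a =
    zeroCornerMatrix a - single 5 5 (trace (zeroCornerMatrix a)) := rfl

theorem offCorner_tracelessMatrix (a : NonCorner → S) : offCorner (tracelessMatrix a) = a := by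
  rw [tracelessMatrix_apply, map_sub, offCorner_zeroCornerMatrix, sub_eq_self]
  funext p
  exact single_apply_of_ne _ _ _ _ _ fun h => p.2 (Prod.ext h.1.symm h.2.symm)

theorem trace_tracelessMatrix (a : NonCorner → S) : trace (tracelessMatrix a) = 0 := by
  rw [tracelessMatrix_apply, trace_sub, trace_single_eq_same, sub_self]

theorem tracelessMatrix_offCorner {Z : Matrix (Fin 6) (Fin 6) S} (hZ : trace Z = 0) :
    tracelessMatrix (offCorner Z) = Z := by
  rw [tracelessMatrix_apply, zeroCornerMatrix_offCorner, trace_sub, hZ, trace_single_eq_same,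
    sub_sub, ← single_add, zero_sub, add_neg_cancel, single_zero, sub_zero]

theorem modScalars_apply (Z : Matrix (Fin 6) (Fin 6) S) : modScalars Z = Z - Z 5 5 • 1 := rfl

theorem modScalars_smul_one (r : S) :
    modScalars (r • (1 : Matrix (Fin 6) (Fin 6) S)) = 0 := by
  rw [modScalars_apply, Matrix.smul_apply, one_apply_eq, smul_eq_mul, mul_one, sub_self]

theorem modScalars_zeroCornerMatrix (a : NonCorner → S) :
    modScalars (zeroCornerMatrix a) = zeroCornerMatrix a := by
  have h : (zeroCornerMatrix a : Matrix (Fin 6) (Fin 6) S) 5 5 = 0 := rfl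
  rw [modScalars_apply, h, zero_smul, sub_zero]

theorem zeroCornerMatrix_offCorner_modScalars (Z : Matrix (Fin 6) (Fin 6) S) :
    zeroCornerMatrix (offCorner (modScalars Z)) = Z - Z 5 5 • 1 := by
  have h : modScalars Z 5 5 = 0 := by
    rw [modScalars_apply, Matrix.sub_apply, Matrix.smul_apply, one_apply_eq, smul_eq_mul, mul_one,
      sub_self]
  rw [zeroCornerMatrix_offCorner, h, single_zero, sub_zero, modScalars_apply]

theorem symmMatrix_transpose (a : Sym2 (Fin 6) → S) : (symmMatrix a)ᵀ = symmMatrix a := by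
  ext i j
  exact congrArg a Sym2.eq_swap

theorem symmEntries_symmMatrix (a : Sym2 (Fin 6) → S) : symmEntries (symmMatrix a) = a := by
  funext p
  exact congrArg a (Quot.out_eq p)

theorem symmMatrix_symmEntries {Z : Matrix (Fin 6) (Fin 6) S} (hZ : Zᵀ = Z) :
    symmMatrix (symmEntries Z) = Z := by
  ext i j
  have h : s(s(i, j).out.1, s(i, j).out.2) = s(i, j) := Quot.out_eq s(i, j)
  change Z s(i, j).out.1 s(i, j).out.2 = Z i j
  rcases Sym2.eq_iff.1 h with ⟨h1, h2⟩ | ⟨h1, h2⟩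
  · rw [h1, h2]
  · rw [h1, h2]
    exact congrFun (congrFun hZ i) j

/-- The differentials of the Józefiak–Pragacz complex of a skew-symmetric matrix `X`, in which
`pfAdj X` enters besides `X`. -/
noncomputable def pfDiff (X : Matrix (Fin 6) (Fin 6) S) :
    ∀ i, (PfTerm (i + 1) → S) →ₗ[S] (PfTerm i → S)
  | 0 => LinearMap.pi fun _ => polarPfaffian X ∘ₗ skewMatrix
  | 1 => upperEntries ∘ₗ (LinearMap.mulRight S X + LinearMap.mulLeft S X ∘ₗ
      (transposeLinearEquiv (Fin 6) (Fin 6) S S).toLinearMap) ∘ₗ tracelessMatrix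
  | 2 => offCorner ∘ₗ
      (LinearMap.mulLeft S X ∘ₗ symmMatrix ∘ₗ LinearMap.funLeft S S Sum.inl +
        LinearMap.mulRight S (pfAdj X) ∘ₗ symmMatrix ∘ₗ LinearMap.funLeft S S Sum.inr)
  | 3 => (LinearEquiv.sumArrowLequivProdArrow _ _ S S).symm.toLinearMap ∘ₗ LinearMap.prod
      (symmEntries ∘ₗ (LinearMap.mulLeft S (pfAdj X) ∘ₗ
        (transposeLinearEquiv (Fin 6) (Fin 6) S S).toLinearMap - LinearMap.mulRight S (pfAdj X)) ∘ₗ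
          zeroCornerMatrix)
      (symmEntries ∘ₗ (LinearMap.mulLeft S X - LinearMap.mulRight S X ∘ₗ
        (transposeLinearEquiv (Fin 6) (Fin 6) S S).toLinearMap) ∘ₗ zeroCornerMatrix)
  | 4 => offCorner ∘ₗ modScalars ∘ₗ LinearMap.mulRight S X ∘ₗ skewMatrix
  | 5 => LinearMap.toSpanSingleton S _ (upperEntries (pfAdj X)) ∘ₗ LinearMap.proj ()
  | _ + 6 => 0

section Apply

variable (X : Matrix (Fin 6) (Fin 6) S)

theorem pfDiff_zero (c : Fin 15 → S) :
    pfDiff X 0 c = fun _ => polarPfaffian X (skewMatrix c) := rfl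

theorem pfDiff_one (a : NonCorner → S) : pfDiff X 1 a =
    upperEntries (tracelessMatrix a * X + X * (tracelessMatrix a)ᵀ) := rfl

theorem pfDiff_two (v : Sym2 (Fin 6) ⊕ Sym2 (Fin 6) → S) : pfDiff X 2 v =
    offCorner (X * symmMatrix (v ∘ Sum.inl) + symmMatrix (v ∘ Sum.inr) * pfAdj X) := rfl

theorem pfDiff_three (b : NonCorner → S) : pfDiff X 3 b = Sum.elim
    (symmEntries (pfAdj X * (zeroCornerMatrix b)ᵀ - zeroCornerMatrix b * pfAdj X))
    (symmEntries (X * zeroCornerMatrix b - (zeroCornerMatrix b)ᵀ * X)) := rfl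

theorem pfDiff_four (c : Fin 15 → S) : pfDiff X 4 c =
    offCorner (modScalars (skewMatrix c * X)) := rfl

theorem pfDiff_five (r : Unit → S) : pfDiff X 5 r = r () • upperEntries (pfAdj X) := rfl

end Apply

end Complex

section Boundaries

variable {S : Type*} [CommRing S] {X : Matrix (Fin 6) (Fin 6) S}

theorem trace_mul_eq_zero_of_skew_symm {n : Type*} [Fintype n] (h2 : IsUnit (2 : S))
    {M P : Matrix n n S} (hM : Mᵀ = -M) (hP : Pᵀ = P) : trace (M * P) = 0 := by
  have h : trace (M * P) = -trace (M * P) := by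
    conv_lhs => rw [← trace_transpose, transpose_mul, hM, hP, mul_neg, trace_neg, trace_mul_comm]
  exact h2.mul_right_eq_zero.1 (by linear_combination h)

theorem mul_add_mul_transpose_skew (hX : Xᵀ = -X) (A : Matrix (Fin 6) (Fin 6) S) :
    (A * X + X * Aᵀ)ᵀ = -(A * X + X * Aᵀ) := by
  rw [transpose_add, transpose_mul, transpose_mul, transpose_transpose, hX, mul_neg, neg_mul]
  abel

theorem mul_transpose_sub_mul_symm {Y : Matrix (Fin 6) (Fin 6) S} (hY : Yᵀ = -Y)
    (B : Matrix (Fin 6) (Fin 6) S) : (Y * Bᵀ - B * Y)ᵀ = Y * Bᵀ - B * Y := by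
  rw [transpose_sub, transpose_mul, transpose_mul, transpose_transpose, hY, mul_neg, neg_mul]
  abel

theorem mul_sub_transpose_mul_symm (hX : Xᵀ = -X) (B : Matrix (Fin 6) (Fin 6) S) :
    (X * B - Bᵀ * X)ᵀ = X * B - Bᵀ * X := by
  simpa only [transpose_transpose] using mul_transpose_sub_mul_symm hX Bᵀ

theorem polarPfaffian_mul_add_mul_transpose (h2 : IsUnit (2 : S)) (hX : Xᵀ = -X)
    {A : Matrix (Fin 6) (Fin 6) S} (hA : trace A = 0) :
    polarPfaffian X (A * X + X * Aᵀ) = 0 := by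
  refine h2.mul_right_eq_zero.1 ?_
  rw [← trace_mul_pfAdj h2 (mul_add_mul_transpose_skew hX A), add_mul, trace_add, mul_assoc,
    mul_pfAdj h2 hX, mul_assoc, trace_mul_comm X, mul_assoc, pfAdj_mul h2 hX]
  simp [hA]

theorem trace_mul_add_mul_pfAdj (h2 : IsUnit (2 : S)) (hX : Xᵀ = -X)
    {P T : Matrix (Fin 6) (Fin 6) S} (hP : Pᵀ = P) (hT : Tᵀ = T) :
    trace (X * P + T * pfAdj X) = 0 := by
  rw [trace_add, trace_mul_eq_zero_of_skew_symm h2 hX hP, trace_mul_comm,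
    trace_mul_eq_zero_of_skew_symm h2 (pfAdj_transpose X) hT, add_zero]

theorem symm_boundary_boundary (h2 : IsUnit (2 : S)) (hX : Xᵀ = -X)
    {P T : Matrix (Fin 6) (Fin 6) S} (hP : Pᵀ = P) (hT : Tᵀ = T) :
    (X * P + T * pfAdj X) * X + X * (X * P + T * pfAdj X)ᵀ = 0 := by
  rw [transpose_add, transpose_mul, transpose_mul, hP, hT, hX, pfAdj_transpose X, add_mul, mul_add,
    mul_assoc T, pfAdj_mul h2 hX, neg_mul, mul_neg, mul_neg, mul_neg, ← mul_assoc X (pfAdj X),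
    mul_pfAdj h2 hX, mul_assoc X P X]
  simp only [mul_smul_comm, smul_mul_assoc, mul_one, one_mul]
  abel

theorem modScalars_boundary_boundary (h2 : IsUnit (2 : S)) (hX : Xᵀ = -X)
    (B : Matrix (Fin 6) (Fin 6) S) :
    X * (pfAdj X * Bᵀ - B * pfAdj X) + (X * B - Bᵀ * X) * pfAdj X = 0 := by
  rw [mul_sub, sub_mul, ← mul_assoc, mul_pfAdj h2 hX, mul_assoc Bᵀ, mul_pfAdj h2 hX, mul_assoc X B]
  simp only [mul_smul_comm, smul_mul_assoc, mul_one, one_mul]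
  abel

theorem mul_transpose_sub_mul_sub_smul_one (Y B : Matrix (Fin 6) (Fin 6) S) (r : S) :
    Y * (B - r • 1)ᵀ - (B - r • 1) * Y = Y * Bᵀ - B * Y := by
  simp only [transpose_sub, transpose_smul, transpose_one, mul_sub, sub_mul, mul_smul_comm,
    smul_mul_assoc, mul_one, one_mul, sub_sub_sub_cancel_right]

theorem mul_sub_transpose_mul_sub_smul_one (Y B : Matrix (Fin 6) (Fin 6) S) (r : S) :
    Y * (B - r • 1) - (B - r • 1)ᵀ * Y = Y * B - Bᵀ * Y := by
  simpa only [transpose_transpose, transpose_sub, transpose_smul, transpose_one] using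
    mul_transpose_sub_mul_sub_smul_one Y Bᵀ r

theorem pfAdj_mul_transpose_sub_mul_pfAdj (h2 : IsUnit (2 : S)) (hX : Xᵀ = -X)
    {C : Matrix (Fin 6) (Fin 6) S} (hC : Cᵀ = -C) :
    pfAdj X * (C * X)ᵀ - C * X * pfAdj X = 0 := by
  rw [transpose_mul, hC, hX, neg_mul_neg, ← mul_assoc, pfAdj_mul h2 hX, mul_assoc,
    mul_pfAdj h2 hX, smul_mul_assoc, one_mul, mul_smul_comm, mul_one, sub_self]

theorem mul_mul_sub_transpose_mul (hX : Xᵀ = -X) {C : Matrix (Fin 6) (Fin 6) S} (hC : Cᵀ = -C) :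
    X * (C * X) - (C * X)ᵀ * X = 0 := by
  rw [transpose_mul, hC, hX, neg_mul_neg, mul_assoc, sub_self]

theorem pfDiff_three_offCorner_modScalars (B : Matrix (Fin 6) (Fin 6) S) :
    pfDiff X 3 (offCorner (modScalars B)) = Sum.elim
      (symmEntries (pfAdj X * Bᵀ - B * pfAdj X)) (symmEntries (X * B - Bᵀ * X)) := by
  rw [pfDiff_three, zeroCornerMatrix_offCorner_modScalars, mul_transpose_sub_mul_sub_smul_one,
    mul_sub_transpose_mul_sub_smul_one]

theorem pfDiff_pfDiff (h2 : IsUnit (2 : S)) (hX : Xᵀ = -X) :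
    ∀ (i : ℕ) (v : PfTerm (i + 1 + 1) → S), pfDiff X i (pfDiff X (i + 1) v) = 0
  | 0, (a : NonCorner → S) => by
    rw [pfDiff_one, pfDiff_zero, skewMatrix_upperEntries h2 (mul_add_mul_transpose_skew hX _),
      polarPfaffian_mul_add_mul_transpose h2 hX (trace_tracelessMatrix a)]
    rfl
  | 1, (v : Sym2 (Fin 6) ⊕ Sym2 (Fin 6) → S) => by
    have hP := symmMatrix_transpose (v ∘ Sum.inl)
    have hT := symmMatrix_transpose (v ∘ Sum.inr)
    rw [pfDiff_two, pfDiff_one, tracelessMatrix_offCorner (trace_mul_add_mul_pfAdj h2 hX hP hT),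
      symm_boundary_boundary h2 hX hP hT]
    exact map_zero upperEntries
  | 2, (b : NonCorner → S) => by
    rw [pfDiff_three, pfDiff_two, Sum.elim_comp_inl, Sum.elim_comp_inr,
      symmMatrix_symmEntries (mul_transpose_sub_mul_symm (pfAdj_transpose X) _),
      symmMatrix_symmEntries (mul_sub_transpose_mul_symm hX _),
      modScalars_boundary_boundary h2 hX]
    exact map_zero offCorner
  | 3, (c : Fin 15 → S) => by
    rw [pfDiff_four, pfDiff_three_offCorner_modScalars,
      pfAdj_mul_transpose_sub_mul_pfAdj h2 hX (skewMatrix_transpose c),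
      mul_mul_sub_transpose_mul hX (skewMatrix_transpose c), map_zero]
    exact Sum.elim_zero_zero
  | 4, (r : Unit → S) => by
    rw [pfDiff_five, pfDiff_four, map_smul, skewMatrix_upperEntries h2 (pfAdj_transpose X),
      smul_mul_assoc, pfAdj_mul h2 hX, smul_smul, modScalars_smul_one]
    exact map_zero offCorner
  | 5, _ => map_zero (pfDiff X 5)
  | _ + 6, _ => rfl

end Boundaries

section Annihilation

variable {S : Type*} [CommRing S] {X M : Matrix (Fin 6) (Fin 6) S}

theorem exists_pfDiff_one_eq (h2 : IsUnit (2 : S)) (hX : Xᵀ = -X) (hM : Mᵀ = -M) {c : Fin 15 → S}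
    (hc : pfDiff X 0 c = 0) : ∃ a, pfDiff X 1 a = (2 * polarPfaffian X M) • c := by
  have hc : polarPfaffian X (skewMatrix c) = 0 := congrFun hc ()
  obtain ⟨htrace, hboundary⟩ := skew_homotopy h2 hX hM (skewMatrix_transpose c) rfl
  rw [hc, mul_zero, zero_smul, sub_zero] at hboundary
  refine ⟨offCorner (skewMatrix c * polarAdj X M - M * polarAdj X (skewMatrix c)),
    (pfDiff_one X _).trans ?_⟩
  rw [tracelessMatrix_offCorner htrace, hboundary, map_smul, upperEntries_skewMatrix]

theorem exists_pfDiff_two_eq (h2 : IsUnit (2 : S)) (hX : Xᵀ = -X) (hM : Mᵀ = -M)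
    {a : NonCorner → S} (ha : pfDiff X 1 a = 0) :
    ∃ v, pfDiff X 2 v = (2 * polarPfaffian X M) • a := by
  have hd : tracelessMatrix a * X + X * (tracelessMatrix a)ᵀ = 0 := by
    rw [← skewMatrix_upperEntries h2 (mul_add_mul_transpose_skew hX (tracelessMatrix a)),
      ← pfDiff_one, ha]
    exact map_zero skewMatrix
  have hP := mul_transpose_sub_mul_symm (polarAdj_transpose X M) (tracelessMatrix a)ᵀ
  have hT := mul_transpose_sub_mul_symm hM (tracelessMatrix a)
  rw [transpose_transpose] at hP
  refine ⟨Sum.elim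
    (symmEntries (polarAdj X M * tracelessMatrix a - (tracelessMatrix a)ᵀ * polarAdj X M))
    (-symmEntries (M * (tracelessMatrix a)ᵀ - tracelessMatrix a * M)), (pfDiff_two X _).trans ?_⟩
  rw [Sum.elim_comp_inl, Sum.elim_comp_inr, map_neg, symmMatrix_symmEntries hP,
    symmMatrix_symmEntries hT, neg_sub, traceless_homotopy h2 hX hM (trace_tracelessMatrix a) hd,
    map_smul, offCorner_tracelessMatrix]

theorem exists_pfDiff_three_eq (h2 : IsUnit (2 : S)) (hX : Xᵀ = -X) (hM : Mᵀ = -M)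
    {v : Sym2 (Fin 6) ⊕ Sym2 (Fin 6) → S} (hv : pfDiff X 2 v = 0) :
    ∃ b, pfDiff X 3 b = (2 * polarPfaffian X M) • v := by
  have hP := symmMatrix_transpose (v ∘ Sum.inl)
  have hT := symmMatrix_transpose (v ∘ Sum.inr)
  have hd : X * symmMatrix (v ∘ Sum.inl) + symmMatrix (v ∘ Sum.inr) * pfAdj X = 0 := by
    rw [← tracelessMatrix_offCorner (trace_mul_add_mul_pfAdj h2 hX hP hT), ← pfDiff_two, hv]
    exact map_zero tracelessMatrix
  obtain ⟨hB, hB'⟩ := symm_homotopy h2 hX hM hP hT hd rfl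
  refine ⟨offCorner (modScalars
    (polarAdj X M * symmMatrix (v ∘ Sum.inr) - symmMatrix (v ∘ Sum.inl) * M)),
    (pfDiff_three_offCorner_modScalars _).trans ?_⟩
  rw [hB, hB', map_smul, map_smul, symmEntries_symmMatrix,
    symmEntries_symmMatrix]
  exact Sum.elim_comp_inl_inr ((2 * polarPfaffian X M) • v)

theorem exists_pfDiff_four_eq (h2 : IsUnit (2 : S)) (hX : Xᵀ = -X) (hM : Mᵀ = -M)
    {b : NonCorner → S} (hb : pfDiff X 3 b = 0) :
    ∃ c, pfDiff X 4 c = (2 * polarPfaffian X M) • b := by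
  have symm_eq_zero : ∀ {Z : Matrix (Fin 6) (Fin 6) S}, Zᵀ = Z → symmEntries Z = 0 → Z = 0 :=
    fun hZ h => by rw [← symmMatrix_symmEntries hZ, h, map_zero]
  rw [pfDiff_three] at hb
  obtain ⟨r, hr⟩ := exists_modScalarsHomotopy_mul_eq h2 hX hM
    (symm_eq_zero (mul_transpose_sub_mul_symm (pfAdj_transpose X) _)
      (funext fun p => congrFun hb (Sum.inl p)))
    (symm_eq_zero (mul_sub_transpose_mul_symm hX _) (funext fun p => congrFun hb (Sum.inr p)))
  refine ⟨upperEntries (modScalarsHomotopy X M (zeroCornerMatrix b)),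
    (pfDiff_four X _).trans ?_⟩
  rw [skewMatrix_upperEntries h2 (modScalarsHomotopy_transpose _), hr, map_add,
    modScalars_smul_one, add_zero, map_smul, modScalars_zeroCornerMatrix, map_smul,
    offCorner_zeroCornerMatrix]

theorem exists_pfDiff_five_eq (h2 : IsUnit (2 : S)) (hX : Xᵀ = -X) (hM : Mᵀ = -M)
    {c : Fin 15 → S} (hc : pfDiff X 4 c = 0) :
    ∃ r, pfDiff X 5 r = (2 * polarPfaffian X M) • c := by
  have hscalar : skewMatrix c * X = (skewMatrix c * X) 5 5 • 1 := by
    rw [← sub_eq_zero, ← zeroCornerMatrix_offCorner_modScalars, ← pfDiff_four, hc]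
    exact map_zero zeroCornerMatrix
  refine ⟨fun _ : Unit => trace (M * skewMatrix c), (pfDiff_five X _).trans ?_⟩
  rw [← map_smul, skew_homotopy_of_mul_eq_scalar h2 hX hM (skewMatrix_transpose c) hscalar,
    map_smul, upperEntries_skewMatrix]

theorem pfDiff_six_eq (h2 : IsUnit (2 : S)) (hM : Mᵀ = -M) {r : Unit → S}
    (hr : pfDiff X 5 r = 0) (z : PfTerm 7 → S) :
    pfDiff X 6 z = (2 * polarPfaffian X M) • r := by
  have hY : r () • pfAdj X = 0 := by
    rw [← skewMatrix_upperEntries h2 (pfAdj_transpose X), ← map_smul, ← pfDiff_five, hr]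
    exact map_zero skewMatrix
  funext _
  change 0 = 2 * polarPfaffian X M * r ()
  rw [← trace_mul_pfAdj h2 hM, mul_comm, ← smul_eq_mul, ← trace_smul, ← mul_smul_comm, hY,
    mul_zero, trace_zero]

theorem exists_pfDiff_eq_polarPfaffian_smul (h2 : IsUnit (2 : S)) (hX : Xᵀ = -X) (hM : Mᵀ = -M) :
    ∀ (i : ℕ) (v : PfTerm (i + 1) → S), pfDiff X i v = 0 →
      ∃ u, pfDiff X (i + 1) u = (2 * polarPfaffian X M) • v
  | 0, _, h => exists_pfDiff_one_eq h2 hX hM h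
  | 1, _, h => exists_pfDiff_two_eq h2 hX hM h
  | 2, _, h => exists_pfDiff_three_eq h2 hX hM h
  | 3, _, h => exists_pfDiff_four_eq h2 hX hM h
  | 4, _, h => exists_pfDiff_five_eq h2 hX hM h
  | 5, _, h => ⟨0, pfDiff_six_eq h2 hM h 0⟩
  | _ + 6, _, _ => ⟨0, funext fun a : Empty => a.elim⟩

/-- The ideal generated by the Pfaffians of the principal `4 × 4` blocks of `X`. -/
def pfaffianIdeal (X : Matrix (Fin 6) (Fin 6) S) : Ideal S :=
  Ideal.span (Set.range (upperEntries (pfAdj X)))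

theorem mem_pfaffianIdeal_iff {a : S} :
    a ∈ pfaffianIdeal X ↔ ∃ c, polarPfaffian X (skewMatrix c) = a := by
  simp only [pfaffianIdeal, Ideal.mem_span_range_iff_exists_fun, polarPfaffian_skewMatrix]
  constructor
  · rintro ⟨c, rfl⟩
    exact ⟨-c, by rw [neg_dotProduct, neg_neg, dotProduct]⟩
  · rintro ⟨c, rfl⟩
    exact ⟨-c, by rw [← neg_dotProduct, dotProduct]⟩

theorem mem_pfaffianIdeal_iff_mem_range {v : Unit → S} :
    v () ∈ pfaffianIdeal X ↔ v ∈ LinearMap.range (pfDiff X 0) := by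
  rw [mem_pfaffianIdeal_iff]
  exact exists_congr fun c => ⟨fun h => funext fun _ => h, fun h => congrFun h ()⟩

theorem exists_pfDiff_eq_smul (h2 : IsUnit (2 : S)) (hX : Xᵀ = -X) {a : S}
    (ha : a ∈ pfaffianIdeal X) {i : ℕ} {v : PfTerm (i + 1) → S} (hv : pfDiff X i v = 0) :
    a • v ∈ LinearMap.range (pfDiff X (i + 1)) := by
  obtain ⟨c, rfl⟩ := mem_pfaffianIdeal_iff.1 ha
  obtain ⟨b, hb⟩ := h2.exists_left_inv
  obtain ⟨u, hu⟩ :=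
    exists_pfDiff_eq_polarPfaffian_smul h2 hX (skewMatrix_transpose c) i v hv
  exact ⟨b • u, by rw [map_smul, hu, smul_smul, ← mul_assoc, hb, one_mul]⟩

end Annihilation

section Reduction

variable {S S' : Type*} [CommRing S] [CommRing S'] {f : S →+* S'} {a : S}

theorem exists_eq_smul_of_comp_eq_zero {ι : Type*} (hker : RingHom.ker f = Ideal.span {a})
    {v : ι → S} (hv : f ∘ v = 0) : ∃ w, v = a • w := by
  have h : ∀ j, ∃ r, v j = a * r := fun j => Ideal.mem_span_singleton.1 (hker ▸ congrFun hv j)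
  choose w hw using h
  exact ⟨w, funext hw⟩

theorem mem_range_of_smul_mem_range {ι κ ν : Type*} (hf : Function.Surjective f)
    (hker : RingHom.ker f = Ideal.span {a}) (ha : IsSMulRegular S a)
    {d : (κ → S) →ₗ[S] (ι → S)} {e : (ν → S) →ₗ[S] (κ → S)}
    {d' : (κ → S') →ₗ[S'] (ι → S')} {e' : (ν → S') →ₗ[S'] (κ → S')}
    (hd : ∀ u, f ∘ d u = d' (f ∘ u)) (he : ∀ w, f ∘ e w = e' (f ∘ w))
    (hde : ∀ w, d (e w) = 0) (hexact : Function.Exact e' d') {v : ι → S}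
    (hv : a • v ∈ LinearMap.range d) : v ∈ LinearMap.range d := by
  obtain ⟨u, hu⟩ := hv
  have hfa : f a = 0 := RingHom.mem_ker.1 (hker ▸ Ideal.mem_span_singleton_self a)
  have hfu : d' (f ∘ u) = 0 := by
    rw [← hd, hu]
    exact funext fun j => by simp [hfa]
  obtain ⟨w', hw'⟩ := (hexact _).1 hfu
  obtain ⟨w, rfl⟩ := hf.comp_left w'
  obtain ⟨z, hz⟩ := exists_eq_smul_of_comp_eq_zero hker (v := u - e w) <| funext fun j => by
    simpa [sub_eq_zero] using congrFun (hw'.symm.trans (he w).symm) j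
  have hz' : a • d z = a • v := by rw [← map_smul, ← hz, map_sub, hde, sub_zero, hu]
  exact ⟨z, funext fun j => ha (congrFun hz' j)⟩

open RingTheory.Sequence Pointwise in
theorem isWeaklyRegular_cons_iff_of_surjective (hf : Function.Surjective f)
    (hker : RingHom.ker f = Ideal.span {a}) (rs : List S) :
    IsWeaklyRegular S (a :: rs) ↔ IsSMulRegular S a ∧ IsWeaklyRegular S' (rs.map f) := by
  let := f.toAlgebra
  have h : a • (⊤ : Submodule S S) = LinearMap.ker (Algebra.linearMap S S') := by
    rw [← Submodule.ideal_span_singleton_smul, ← hker, smul_eq_mul, Ideal.mul_top]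
    rfl
  let e : QuotSMulTop a S ≃ₗ[S] S' := (Submodule.quotEquivOfEq _ _ h).trans
    ((Algebra.linearMap S S').quotKerEquivOfSurjective hf)
  rw [isWeaklyRegular_cons_iff, e.isWeaklyRegular_congr rs,
    ← isWeaklyRegular_map_algebraMap_iff S' S' rs]
  rfl

end Reduction

section BaseChange

variable {S S' : Type*} [CommRing S] [CommRing S'] (f : S →+* S')

theorem skewMatrix_map (x : Fin 15 → S) :
    f.mapMatrix (skewMatrix x) = skewMatrix (f ∘ x) := by
  ext i j
  fin_cases i <;> fin_cases j <;> simp [skewMatrix_apply]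

theorem upperEntries_map (Z : Matrix (Fin 6) (Fin 6) S) :
    f ∘ upperEntries Z = upperEntries (f.mapMatrix Z) := by
  funext k
  fin_cases k <;> rfl

theorem pfAdj_map (X : Matrix (Fin 6) (Fin 6) S) :
    f.mapMatrix (pfAdj X) = pfAdj (f.mapMatrix X) := by
  rw [pfAdj, skewComplement, skewMatrix_map]
  refine congrArg skewMatrix (funext fun k => ?_)
  fin_cases k <;> simp [blockPfaffian]

theorem mapMatrix_transpose (Z : Matrix (Fin 6) (Fin 6) S) :
    f.mapMatrix Zᵀ = (f.mapMatrix Z)ᵀ := rfl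

theorem polarPfaffian_map (X M : Matrix (Fin 6) (Fin 6) S) :
    f (polarPfaffian X M) = polarPfaffian (f.mapMatrix X) (f.mapMatrix M) :=
  (map_neg f _).trans <| congrArg Neg.neg <| (RingHom.map_dotProduct f _ _).trans <| by
    rw [upperEntries_map, upperEntries_map, pfAdj_map]

theorem zeroCornerMatrix_map (a : NonCorner → S) :
    f.mapMatrix (zeroCornerMatrix a) = zeroCornerMatrix (f ∘ a) := by
  ext i j
  exact (apply_dite f _ _ _).trans (dite_congr rfl (fun _ => map_zero f) fun _ => rfl)

theorem offCorner_map (Z : Matrix (Fin 6) (Fin 6) S) :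
    f ∘ offCorner Z = offCorner (f.mapMatrix Z) := rfl

theorem tracelessMatrix_map (a : NonCorner → S) :
    f.mapMatrix (tracelessMatrix a) = tracelessMatrix (f ∘ a) := by
  rw [tracelessMatrix_apply, tracelessMatrix_apply, map_sub, ← zeroCornerMatrix_map]
  exact congrArg _ ((map_single 5 5 _ f).trans (congrArg _ (AddMonoidHom.map_trace f _)))

theorem modScalars_map (Z : Matrix (Fin 6) (Fin 6) S) :
    f.mapMatrix (modScalars Z) = modScalars (f.mapMatrix Z) := by
  rw [modScalars_apply, modScalars_apply, map_sub]
  refine congrArg₂ _ rfl ?_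
  exact (Matrix.map_smul' f _ 1 (map_mul f)).trans (congrArg _ (map_one f.mapMatrix))

theorem symmEntries_map (Z : Matrix (Fin 6) (Fin 6) S) :
    f ∘ symmEntries Z = symmEntries (f.mapMatrix Z) := rfl

theorem pfDiff_map (X : Matrix (Fin 6) (Fin 6) S) :
    ∀ i (v : PfTerm (i + 1) → S), f ∘ pfDiff X i v = pfDiff (f.mapMatrix X) i (f ∘ v)
  | 0, (c : Fin 15 → S) => funext fun _ =>
    (polarPfaffian_map f X _).trans (congrArg _ (skewMatrix_map f c))
  | 1, (a : NonCorner → S) => by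
    refine (upperEntries_map f (tracelessMatrix a * X + X * (tracelessMatrix a)ᵀ)).trans ?_
    rw [map_add, map_mul, map_mul, mapMatrix_transpose, tracelessMatrix_map]
    rfl
  | 2, (v : Sym2 (Fin 6) ⊕ Sym2 (Fin 6) → S) => by
    refine (offCorner_map f
      (X * symmMatrix (v ∘ Sum.inl) + symmMatrix (v ∘ Sum.inr) * pfAdj X)).trans ?_
    rw [map_add, map_mul, map_mul, pfAdj_map]
    rfl
  | 3, (b : NonCorner → S) => by
    refine (Sum.comp_elim f
      (symmEntries (pfAdj X * (zeroCornerMatrix b)ᵀ - zeroCornerMatrix b * pfAdj X))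
      (symmEntries (X * zeroCornerMatrix b - (zeroCornerMatrix b)ᵀ * X))).trans ?_
    rw [symmEntries_map, symmEntries_map]
    simp only [map_sub, map_mul, mapMatrix_transpose, pfAdj_map, zeroCornerMatrix_map]
    rfl
  | 4, (c : Fin 15 → S) => by
    refine (offCorner_map f (modScalars (skewMatrix c * X))).trans ?_
    rw [modScalars_map, map_mul, skewMatrix_map]
    rfl
  | 5, (r : Unit → S) => funext fun j => (map_mul f _ _).trans <| congrArg _ <|
    (congrFun (upperEntries_map f _) j).trans (congrFun (congrArg upperEntries (pfAdj_map f X)) j)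
  | _ + 6, _ => funext fun _ => map_zero f

theorem pfaffianIdeal_map (X : Matrix (Fin 6) (Fin 6) S) :
    (pfaffianIdeal X).map f = pfaffianIdeal (f.mapMatrix X) := by
  rw [pfaffianIdeal, Ideal.map_span, ← Set.range_comp, upperEntries_map, pfAdj_map, pfaffianIdeal]

end BaseChange

section Acyclicity

open RingTheory.Sequence

/-- Homotopies make every element of the Pfaffian ideal annihilate the homology, so that a
nonzerodivisor in the ideal embeds it into the homology of the reduced complex one degree higher. -/
theorem exact_pfDiff_of_isWeaklyRegular {S : Type*} [CommRing S] (h2 : IsUnit (2 : S))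
    {X : Matrix (Fin 6) (Fin 6) S} (hX : Xᵀ = -X) :
    ∀ (rs : List S), (∀ r ∈ rs, r ∈ pfaffianIdeal X) → IsWeaklyRegular S rs →
      ∀ i, 6 ≤ i + rs.length → Function.Exact (pfDiff X (i + 1)) (pfDiff X i)
  | [], _, _, i, hi => by
    obtain ⟨j, rfl⟩ := Nat.exists_eq_add_of_le' hi
    have : IsEmpty (PfTerm (j + 6 + 1)) := inferInstanceAs (IsEmpty Empty)
    exact fun v => ⟨fun _ => ⟨0, Subsingleton.elim _ _⟩, fun _ => rfl⟩
  | a :: rs, hmem, hrs, i, hi => by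
    let f := Ideal.Quotient.mk (Ideal.span {a})
    have hf : Function.Surjective f := Ideal.Quotient.mk_surjective
    have hker : RingHom.ker f = Ideal.span {a} := Ideal.mk_ker
    obtain ⟨ha, hrs'⟩ := (isWeaklyRegular_cons_iff_of_surjective hf hker rs).1 hrs
    have hX' : (f.mapMatrix X)ᵀ = -f.mapMatrix X := by rw [← mapMatrix_transpose, hX, map_neg]
    have hmem' : ∀ r ∈ rs.map f, r ∈ pfaffianIdeal (f.mapMatrix X) := by
      rintro _ hr
      obtain ⟨r, hr', rfl⟩ := List.mem_map.1 hr
      exact pfaffianIdeal_map f X ▸ Ideal.mem_map_of_mem f (hmem r (List.mem_cons_of_mem a hr'))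
    have hlen : 6 ≤ i + 1 + (rs.map f).length := by
      rw [List.length_cons] at hi
      rw [List.length_map]
      lia
    have hexact := exact_pfDiff_of_isWeaklyRegular (map_ofNat f 2 ▸ h2.map f) hX' (rs.map f)
      hmem' hrs' (i + 1) hlen
    refine fun v => ⟨fun hv => ?_, ?_⟩
    · exact mem_range_of_smul_mem_range hf hker ha (pfDiff_map f X (i + 1))
        (pfDiff_map f X (i + 2)) (pfDiff_pfDiff h2 hX (i + 1)) hexact
        (exists_pfDiff_eq_smul h2 hX (hmem a List.mem_cons_self) hv)
    · rintro ⟨u, rfl⟩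
      exact pfDiff_pfDiff h2 hX i u
  termination_by rs => rs.length

end Acyclicity

/-! ## Regular sequences from integral equations -/

section MonicRegularSequence

variable {B B' : Type*} [CommRing B] [CommRing B'] {σ : Type*}

theorem isSMulRegular_C {t : B} (ht : IsSMulRegular B t) :
    IsSMulRegular (MvPolynomial σ B) (C t : MvPolynomial σ B) := by
  intro p q hpq
  ext m
  apply ht
  simpa only [smul_eq_mul, coeff_C_mul] using congrArg (coeff m) hpq

theorem ker_map_eq_span_C {φ : B →+* B'} {t : B} (hφ : RingHom.ker φ = Ideal.span {t}) :
    RingHom.ker (MvPolynomial.map (σ := σ) φ) = Ideal.span {C t} := by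
  rw [MvPolynomial.ker_map, hφ, Ideal.map_span, Set.image_singleton]

theorem isSMulRegular_map_ringEquiv (e : B ≃+* B') {t : B} :
    IsSMulRegular B' (e t) ↔ IsSMulRegular B t :=
  (Equiv.isSMulRegular_congr (e := e.toEquiv) fun _ => map_mul e _ _).symm

theorem isWeaklyRegular_map_ringEquiv (e : B ≃+* B') {rs : List B} :
    RingTheory.Sequence.IsWeaklyRegular B' (rs.map e) ↔
      RingTheory.Sequence.IsWeaklyRegular B rs :=
  (AddEquiv.isWeaklyRegular_congr (e := (e : B ≃+ B')) (List.forall₂_map_right_iff.2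
    (List.forall₂_same.2 fun _ _ _ => map_mul e _ _))).symm

variable (B) in
/-- The first of `n + 1` variables moved into the coefficients. It is what the induction on the
number of variables in `exists_isWeaklyRegular_of_monic` rests on. -/
noncomputable def firstVariableEquiv (n : ℕ) :
    MvPolynomial (Fin (n + 1)) B ≃+* MvPolynomial (Fin n) (Polynomial B) :=
  ((renameEquiv B (_root_.finSuccEquiv n)).trans (optionEquivRight B (Fin n))).toRingEquiv

theorem firstVariableEquiv_aeval_zero {n : ℕ} (a : Polynomial B) :
    firstVariableEquiv B n (Polynomial.aeval (X 0) a) = C a := by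
  have h : ((renameEquiv B (_root_.finSuccEquiv n)).trans
      (optionEquivRight B (Fin n))).toAlgHom.comp (Polynomial.aeval (X 0)) =
      IsScalarTower.toAlgHom B (Polynomial B) _ := by
    ext; simp [algebraMap_eq]
  exact DFunLike.congr_fun h a

theorem firstVariableEquiv_X_succ {n : ℕ} (i : Fin n) :
    firstVariableEquiv B n (X i.succ) = X i := by
  simp [firstVariableEquiv]

theorem firstVariableEquiv_C {n : ℕ} (r : B) :
    firstVariableEquiv B n (C r) = C (Polynomial.C r) := by
  simp [firstVariableEquiv]

variable {n : ℕ} (a : Polynomial B)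

/-- The quotient of a polynomial ring by a monic relation `a` for its first variable, written again
as a polynomial ring. -/
noncomputable def adjoinFirstRoot :
    MvPolynomial (Fin (n + 1)) B →+* MvPolynomial (Fin n) (AdjoinRoot a) :=
  (MvPolynomial.map (AdjoinRoot.mk a)).comp (firstVariableEquiv B n : _ →+* _)

theorem adjoinFirstRoot_surjective : Function.Surjective (adjoinFirstRoot (n := n) a) :=
  (MvPolynomial.map_surjective _ AdjoinRoot.mk_surjective).comp (firstVariableEquiv B n).surjective

theorem ker_adjoinFirstRoot :
    RingHom.ker (adjoinFirstRoot (n := n) a) = Ideal.span {Polynomial.aeval (X 0) a} := by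
  ext s
  rw [adjoinFirstRoot, RingHom.mem_ker, RingHom.comp_apply, ← RingHom.mem_ker,
    ker_map_eq_span_C (φ := AdjoinRoot.mk a) (t := a) Ideal.mk_ker, Ideal.mem_span_singleton,
    Ideal.mem_span_singleton, ← firstVariableEquiv_aeval_zero]
  exact map_dvd_iff (firstVariableEquiv B n)

theorem isSMulRegular_aeval_X_zero {a : Polynomial B} (ha : a.Monic) :
    IsSMulRegular (MvPolynomial (Fin (n + 1)) B)
      (Polynomial.aeval (X 0 : MvPolynomial (Fin (n + 1)) B) a) := by
  rw [← isSMulRegular_map_ringEquiv (firstVariableEquiv B n), firstVariableEquiv_aeval_zero]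
  exact isSMulRegular_C ha.isRegular.left

theorem adjoinFirstRoot_aeval_X_succ (i : Fin n) (c : Polynomial B) :
    adjoinFirstRoot a (Polynomial.aeval (X i.succ) c) =
      Polynomial.aeval (X i) (c.map (AdjoinRoot.of a)) := by
  have hC : (adjoinFirstRoot (n := n) a).comp (algebraMap B _) =
      (algebraMap (AdjoinRoot a) _).comp (AdjoinRoot.of a) := by
    ext1 r
    simp [adjoinFirstRoot, algebraMap_eq, firstVariableEquiv_C]
  have hX : adjoinFirstRoot a (X i.succ) = X i := by
    simp [adjoinFirstRoot, firstVariableEquiv_X_succ]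
  rw [Polynomial.aeval_def, Polynomial.aeval_def, Polynomial.eval₂_map, Polynomial.hom_eval₂,
    hC, hX]

end MonicRegularSequence

theorem exists_isWeaklyRegular_of_monic : ∀ (n : ℕ) {B : Type*} [CommRing B]
    (J : Ideal (MvPolynomial (Fin n) B)),
    (∀ i, ∃ a : Polynomial B, a.Monic ∧ Polynomial.aeval (X i) a ∈ J) →
    ∃ rs : List (MvPolynomial (Fin n) B), (∀ r ∈ rs, r ∈ J) ∧ rs.length = n ∧
      RingTheory.Sequence.IsWeaklyRegular (MvPolynomial (Fin n) B) rs
  | 0, _, _, _, _ => ⟨[], by simp, rfl, .nil _ _⟩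
  | n + 1, B, _, J, hJ => by
    obtain ⟨a, ha, haJ⟩ := hJ 0
    have hf := adjoinFirstRoot_surjective (n := n) a
    obtain ⟨rs, hrs, hlen, hreg⟩ := exists_isWeaklyRegular_of_monic n
      (J.map (adjoinFirstRoot a)) fun i => by
        obtain ⟨c, hc, hcJ⟩ := hJ i.succ
        exact ⟨c.map (AdjoinRoot.of a), hc.map _,
          adjoinFirstRoot_aeval_X_succ a i c ▸ Ideal.mem_map_of_mem _ hcJ⟩
    obtain ⟨ss, rfl⟩ : rs ∈ Set.range (List.map fun s : J => adjoinFirstRoot a s) := by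
      rw [Set.range_list_map]
      intro r hr
      obtain ⟨s, hs, rfl⟩ := (Ideal.mem_map_iff_of_surjective _ hf).1 (hrs r hr)
      exact ⟨⟨s, hs⟩, rfl⟩
    refine ⟨Polynomial.aeval (X 0) a :: ss.map Subtype.val, ?_, by simpa using hlen,
      (isWeaklyRegular_cons_iff_of_surjective hf (ker_adjoinFirstRoot a) _).2
        ⟨isSMulRegular_aeval_X_zero ha, by rwa [List.map_map]⟩⟩
    simpa [haJ] using fun s hs _ => hs

section Integrality

variable {B A ι : Type*} [CommRing B] [CommRing A] [Algebra B A]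

theorem prod_mem_pow_card {κ : Type*} (N : Submodule B A) (T : Finset κ) {w : κ → A}
    (hw : ∀ i, w i ∈ N) : ∏ i ∈ T, w i ∈ N ^ T.card := by
  classical
  induction T using Finset.induction_on with
  | empty => simp [Submodule.one_le.1 le_rfl]
  | insert i T hi ih =>
    rw [Finset.prod_insert hi, Finset.card_insert_of_notMem hi, pow_succ']
    exact Submodule.mul_mem_mul (hw i) ih

theorem span_range_pow_succ_le [Fintype ι] {v : ι → A} {d : ℕ}
    (hv : ∀ i, v i ^ (d + 1) ∈ Submodule.span B (Set.range v) ^ d) :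
    Submodule.span B (Set.range v) ^ (Fintype.card ι * d + 1) ≤
      Submodule.span B (Set.range v) ^ (Fintype.card ι * d) := by
  classical
  set N := Submodule.span B (Set.range v) with hN
  have hvN : ∀ i, v i ∈ N := fun i => Submodule.subset_span ⟨i, rfl⟩
  rw [hN, Submodule.span_pow, ← hN, Submodule.span_le]
  intro x hx
  obtain ⟨g, rfl⟩ := Set.mem_pow.1 hx
  choose o ho using fun i => (g i).2
  obtain ⟨k, -, hk⟩ := Finset.exists_lt_card_fiber_of_mul_lt_card_of_maps_to
    (s := Finset.univ) (t := Finset.univ) (f := o) (n := d) (fun _ _ => Finset.mem_univ _) (by simp)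
  obtain ⟨T, hT, hTcard⟩ := Finset.exists_subset_card_eq (show d + 1 ≤ _ from hk)
  have hTk : ∏ i ∈ T, v (o i) = v k ^ (d + 1) := by
    rw [← hTcard]
    exact Finset.prod_eq_pow_card fun i hi => by rw [(Finset.mem_filter.1 (hT hi)).2]
  have hTc := prod_mem_pow_card N Tᶜ fun i => hvN (o i)
  have hcard : d + Tᶜ.card = Fintype.card ι * d := by
    have := T.card_add_card_compl
    rw [Fintype.card_fin] at this
    omega
  rw [List.prod_ofFn]
  simp only [← ho]
  rw [← Finset.prod_mul_prod_compl T, hTk]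
  have := Submodule.mul_mem_mul (hv k) hTc
  rwa [← pow_add, hcard] at this

theorem finite_of_pow_succ_mem [Finite ι] {v : ι → A} {d : ℕ}
    (h1 : 1 ∈ Submodule.span B (Set.range v))
    (hv : ∀ i, v i ^ (d + 1) ∈ Submodule.span B (Set.range v) ^ d)
    (hadjoin : Algebra.adjoin B (Set.range v) = ⊤) : Module.Finite B A := by
  set N := Submodule.span B (Set.range v)
  cases nonempty_fintype ι
  set k := Fintype.card ι * d
  have hle : N ^ (k + 1) ≤ N ^ k := span_range_pow_succ_le hv
  have h1k : 1 ∈ N ^ k := by simpa using Submodule.pow_mem_pow N h1 k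
  have hmul : ∀ j, N ^ k * N ^ j ≤ N ^ k := fun j => by
    induction j with
    | zero => simp
    | succ j ih =>
      rw [pow_succ, ← mul_assoc]
      exact (mul_le_mul_left ih N).trans ((pow_succ N k).symm.trans_le hle)
  have hsub : Algebra.adjoin B (Set.range v) ≤
      (N ^ k).toSubalgebra h1k fun x y hx hy => hmul k (Submodule.mul_mem_mul hx hy) :=
    Algebra.adjoin_le fun x hx => hle <| by
      have := Submodule.mul_mem_mul h1k (Submodule.subset_span hx)
      rwa [one_mul, ← pow_succ] at this
  have htop : N ^ k = ⊤ := eq_top_iff.2 fun x _ => hsub (hadjoin ▸ Algebra.mem_top)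
  exact ⟨htop ▸ (Submodule.fg_span (Set.finite_range v)).pow k⟩

end Integrality

/-! ## A linear system of parameters for the Plücker algebra -/

section QuadraticRelations

variable {B A : Type*} [CommRing B] [CommRing A] [Algebra B A] {N : Submodule B A} {y : Fin 6 → A}

theorem mul_mem_pow_three {r q : A} (hr : r ∈ N) (hq : q ∈ N ^ 2) : r * q ∈ N ^ 3 := by
  rw [pow_succ']
  exact Submodule.mul_mem_mul hr hq

theorem mul_mul_self_mem_of_quadratic_relations (hyy : ∀ i j, y i * y j ∈ N ^ 2)
    (h0 : y 0 * y 0 ∈ N) (h1 : y 0 * y 1 ∈ N) (h2 : y 0 * y 3 + y 1 * y 1 ∈ N)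
    (h3 : y 1 * y 4 - y 2 * y 3 ∈ N) (h5 : y 3 * y 3 + y 2 * y 3 + y 1 * y 4 - y 0 * y 5 ∈ N)
    (h6 : y 4 * y 4 + y 3 * y 5 ∈ N) : (y 1 * y 4) * (y 1 * y 4) ∈ N ^ 3 := by
  have h : (y 1 * y 4) * (y 1 * y 4) = (y 0 * y 3 + y 1 * y 1) * (y 4 * y 4)
      - (y 4 * y 4 + y 3 * y 5) * (y 0 * y 3)
      + (y 3 * y 3 + y 2 * y 3 + y 1 * y 4 - y 0 * y 5) * (y 0 * y 5)
      + (y 1 * y 4 - y 2 * y 3) * (y 0 * y 5) - (2 : ℕ) • ((y 0 * y 1) * (y 4 * y 5))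
      + (y 0 * y 0) * (y 5 * y 5) := by
    simp only [nsmul_eq_mul]; push_cast; ring
  rw [h]
  exact add_mem (sub_mem (add_mem (add_mem (sub_mem (mul_mem_pow_three h2 (hyy 4 4))
    (mul_mem_pow_three h6 (hyy 0 3))) (mul_mem_pow_three h5 (hyy 0 5)))
    (mul_mem_pow_three h3 (hyy 0 5))) (nsmul_mem (mul_mem_pow_three h1 (hyy 4 5)) 2))
    (mul_mem_pow_three h0 (hyy 5 5))

theorem pow_four_mem_of_quadratic_relations (hy : ∀ i, y i ∈ N)
    (h0 : y 0 * y 0 ∈ N) (h1 : y 0 * y 1 ∈ N) (h2 : y 0 * y 3 + y 1 * y 1 ∈ N)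
    (h3 : y 1 * y 4 - y 2 * y 3 ∈ N) (h4 : y 2 * y 2 + y 2 * y 3 + y 0 * y 5 ∈ N)
    (h5 : y 3 * y 3 + y 2 * y 3 + y 1 * y 4 - y 0 * y 5 ∈ N) (h6 : y 4 * y 4 + y 3 * y 5 ∈ N)
    (h7 : y 5 * y 5 ∈ N) : ∀ i, y i ^ 4 ∈ N ^ 3 := by
  have hyy : ∀ i j, y i * y j ∈ N ^ 2 := fun i j => by
    rw [pow_two]; exact Submodule.mul_mem_mul (hy i) (hy j)
  have h14 := mul_mul_self_mem_of_quadratic_relations hyy h0 h1 h2 h3 h5 h6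
  have h0055 := mul_mem_pow_three h0 (hyy 5 5)
  have h0145 := mul_mem_pow_three h1 (hyy 4 5)
  have e0 : y 0 ^ 4 = (y 0 * y 0) * (y 0 * y 0) := by ring
  have e1 : y 1 ^ 4 = (y 0 * y 3 + y 1 * y 1) * (y 1 * y 1 - y 0 * y 3)
      + (y 0 * y 0) * (y 3 * y 3) := by ring
  have e2 : y 2 ^ 4 = ((y 2 * y 2 + y 2 * y 3 + y 0 * y 5) + (y 1 * y 4 - y 2 * y 3))
      * (y 2 * y 2 - y 1 * y 4 - y 0 * y 5) + ((y 1 * y 4) * (y 1 * y 4)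
      + (2 : ℕ) • ((y 0 * y 1) * (y 4 * y 5)) + (y 0 * y 0) * (y 5 * y 5)) := by
    simp only [nsmul_eq_mul]; push_cast; ring
  have e3 : y 3 ^ 4 =
      ((y 3 * y 3 + y 2 * y 3 + y 1 * y 4 - y 0 * y 5) + (y 1 * y 4 - y 2 * y 3))
      * (y 3 * y 3 + y 0 * y 5 - (2 : ℕ) • (y 1 * y 4)) + ((y 0 * y 0) * (y 5 * y 5)
      - (4 : ℕ) • ((y 0 * y 1) * (y 4 * y 5)) + (4 : ℕ) • ((y 1 * y 4) * (y 1 * y 4))) := by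
    simp only [nsmul_eq_mul]; push_cast; ring
  have e4 : y 4 ^ 4 = (y 4 * y 4 + y 3 * y 5) * (y 4 * y 4 - y 3 * y 5)
      + (y 5 * y 5) * (y 3 * y 3) := by ring
  have e5 : y 5 ^ 4 = (y 5 * y 5) * (y 5 * y 5) := by ring
  intro i
  fin_cases i
  · exact e0 ▸ mul_mem_pow_three h0 (hyy 0 0)
  · exact e1 ▸ add_mem (mul_mem_pow_three h2 (sub_mem (hyy _ _) (hyy _ _)))
      (mul_mem_pow_three h0 (hyy _ _))
  · exact e2 ▸ add_mem (mul_mem_pow_three (add_mem h4 h3) (sub_mem (sub_mem (hyy _ _) (hyy _ _))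
      (hyy _ _))) (add_mem (add_mem h14 (nsmul_mem h0145 2)) h0055)
  · exact e3 ▸ add_mem (mul_mem_pow_three (add_mem h5 h3) (sub_mem (add_mem (hyy _ _) (hyy _ _))
      (nsmul_mem (hyy _ _) 2))) (add_mem (sub_mem h0055 (nsmul_mem h0145 4)) (nsmul_mem h14 4))
  · exact e4 ▸ add_mem (mul_mem_pow_three h6 (sub_mem (hyy _ _) (hyy _ _)))
      (mul_mem_pow_three h7 (hyy _ _))
  · exact e5 ▸ mul_mem_pow_three h7 (hyy _ _)

end QuadraticRelations

section LinearSection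

variable {B : Type*} [CommRing B] (b : Fin 9 → B)

/-- The coordinates of a linear section of the space of skew-symmetric `6 × 6` matrices, of
codimension nine and displaced by the constants `b`. It is cut out by prescribing the sums of the
entries `(i, j)`, `i < j`, with given `i + j`, which form a system of parameters for the homogeneous
coordinate ring of the Grassmannian of planes. -/
noncomputable def sectionEntries : Fin 15 → MvPolynomial (Fin 6) B :=
  ![C (b 0), C (b 1), X 0, X 1, X 2, -X 0 + C (b 2), -X 1 + C (b 3), X 3, X 4,
    -X 2 - X 3 + C (b 4), -X 4 + C (b 5), X 5, -X 5 + C (b 6), C (b 7), C (b 8)]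

theorem sectionEntries_map {B' : Type*} [CommRing B'] (φ : B →+* B') :
    (MvPolynomial.map φ).mapMatrix (skewMatrix (sectionEntries b)) =
      skewMatrix (sectionEntries (φ ∘ b)) := by
  rw [skewMatrix_map]
  congr 1
  funext k
  fin_cases k <;> simp [sectionEntries]

/-- The coordinate ring of the intersection of the linear section with the locus of rank at most
two. -/
abbrev SectionQuotient : Type _ :=
  MvPolynomial (Fin 6) B ⧸ pfaffianIdeal (skewMatrix (sectionEntries b))

/-- The unit and the variables in the coordinate ring of the section. -/
noncomputable def sectionGenerator (o : Option (Fin 6)) : SectionQuotient b :=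
  Ideal.Quotient.mk _ (o.elim 1 X)

theorem one_mem_span_sectionGenerator :
    1 ∈ Submodule.span B (Set.range (sectionGenerator b)) :=
  Submodule.subset_span ⟨none, map_one _⟩

theorem adjoin_sectionGenerator : Algebra.adjoin B (Set.range (sectionGenerator b)) = ⊤ := by
  have hX : Algebra.adjoin B (Set.range (X : Fin 6 → MvPolynomial (Fin 6) B)) ≤
      (Algebra.adjoin B (Set.range (sectionGenerator b))).comap (Ideal.Quotient.mkₐ B _) :=
    Algebra.adjoin_le fun _ ⟨i, hi⟩ => Algebra.subset_adjoin ⟨some i, by rw [← hi]; rfl⟩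
  rw [adjoin_range_X] at hX
  refine eq_top_iff.2 fun q _ => ?_
  obtain ⟨p, rfl⟩ := Ideal.Quotient.mk_surjective q
  exact hX Algebra.mem_top

theorem quadratic_relations_of_section {A : Type*} [CommRing A] {q : MvPolynomial (Fin 6) B →+* A}
    (hq : ∀ s ∈ pfaffianIdeal (skewMatrix (sectionEntries b)), q s = 0)
    {y : Fin 6 → A} (hy : ∀ i, q (X i) = y i) {β : Fin 9 → A} (hβ : ∀ k, q (C (b k)) = β k) :
    y 0 * y 0 = β 0 * (-y 2 - y 3 + β 4) - β 1 * (-y 1 + β 3) + β 2 * y 0 ∧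
    y 0 * y 1 = β 0 * (-y 4 + β 5) - β 1 * y 3 + β 2 * y 1 ∧
    y 0 * y 3 + y 1 * y 1 = β 0 * (-y 5 + β 6) + β 3 * y 1 ∧
    y 1 * y 4 - y 2 * y 3 = β 0 * β 8 ∧
    y 2 * y 2 + y 2 * y 3 + y 0 * y 5 = β 1 * β 7 + β 4 * y 2 ∧
    y 3 * y 3 + y 2 * y 3 + y 1 * y 4 - y 0 * y 5 =
      -(β 6 * y 0) - β 2 * y 5 + β 2 * β 6 + β 5 * y 1 + β 3 * y 4 - β 3 * β 5 + β 4 * y 3 ∧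
    y 4 * y 4 + y 3 * y 5 = β 8 * (-y 0 + β 2) + β 5 * y 4 ∧
    y 5 * y 5 = β 8 * (-y 2 - y 3 + β 4) - β 7 * (-y 4 + β 5) + β 6 * y 5 := by
  have h : ∀ k, q (upperEntries (pfAdj (skewMatrix (sectionEntries b))) k) = 0 := fun k =>
    hq _ (Ideal.subset_span ⟨k, rfl⟩)
  have e := And.intro (h 14) <| And.intro (h 13) <| And.intro (h 11) <| And.intro (h 9) <|
    And.intro (h 7) <| And.intro (h 4) <| And.intro (h 2) (h 0)
  simp only [pfAdj, skewComplement, upperEntries_skewMatrix] at e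
  simp only [blockPfaffian, skewMatrix_apply, sectionEntries, Matrix.of_apply, Matrix.cons_val,
    map_add, map_sub, map_mul, map_neg, hy, hβ] at e
  obtain ⟨e0, e1, e2, e3, e4, e5, e6, e7⟩ := e
  refine ⟨?_, ?_, ?_, ?_, ?_, ?_, ?_, ?_⟩
  · linear_combination e0
  · linear_combination -e1
  · linear_combination e2
  · linear_combination e3
  · linear_combination e4
  · linear_combination e5
  · linear_combination e6
  · linear_combination e7

theorem map_X_pow_four_mem_of_section {A : Type*} [CommRing A] [Algebra B A] {N : Submodule B A}
    (h1 : 1 ∈ N) {q : MvPolynomial (Fin 6) B →ₐ[B] A}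
    (hq : ∀ s ∈ pfaffianIdeal (skewMatrix (sectionEntries b)), q s = 0)
    (hX : ∀ i, q (X i) ∈ N) (i : Fin 6) : q (X i) ^ 4 ∈ N ^ 3 := by
  obtain ⟨y, hy⟩ : ∃ y : Fin 6 → A, ∀ i, q (X i) = y i := ⟨_, fun _ => rfl⟩
  obtain ⟨β, hβ⟩ : ∃ β : Fin 9 → A, ∀ k, q (C (b k)) = β k := ⟨_, fun _ => rfl⟩
  have hmul : ∀ k {m}, m ∈ N → β k * m ∈ N := fun k m hm => by
    rw [← hβ, ← algebraMap_eq, q.commutes, ← Algebra.smul_def]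
    exact N.smul_mem _ hm
  have hβN : ∀ k, β k ∈ N := fun k => by simpa using hmul k h1
  obtain ⟨e0, e1, e2, e3, e4, e5, e6, e7⟩ := 
    quadratic_relations_of_section b (q := (q : MvPolynomial (Fin 6) B →+* A)) hq hy hβ
  simp only [hy] at hX ⊢
  refine pow_four_mem_of_quadratic_relations hX (e0 ▸ ?_) (e1 ▸ ?_) (e2 ▸ ?_) (e3 ▸ ?_)
    (e4 ▸ ?_) (e5 ▸ ?_) (e6 ▸ ?_) (e7 ▸ ?_) i <;>
  repeat' first
    | exact hX _ | exact hβN _ | apply hmul | apply add_mem | apply sub_mem | apply neg_mem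

theorem sectionGenerator_pow_four_mem (o : Option (Fin 6)) :
    sectionGenerator b o ^ 4 ∈ Submodule.span B (Set.range (sectionGenerator b)) ^ 3 := by
  have h1 := one_mem_span_sectionGenerator b
  obtain _ | i := o
  · have h : sectionGenerator b none = 1 := map_one _
    simpa only [h, one_pow] using Submodule.pow_mem_pow _ h1 3
  · exact map_X_pow_four_mem_of_section b h1 (q := Ideal.Quotient.mkₐ B _)
      (fun _ => Ideal.Quotient.eq_zero_iff_mem.2)
      (fun i => Submodule.subset_span ⟨some i, rfl⟩) i

theorem exists_isWeaklyRegular_section :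
    ∃ rs, (∀ r ∈ rs, r ∈ pfaffianIdeal (skewMatrix (sectionEntries b))) ∧ rs.length = 6 ∧
      RingTheory.Sequence.IsWeaklyRegular (MvPolynomial (Fin 6) B) rs := by
  have hfin : Module.Finite B (SectionQuotient b) := finite_of_pow_succ_mem
    (one_mem_span_sectionGenerator b) (sectionGenerator_pow_four_mem b) (adjoin_sectionGenerator b)
  refine exists_isWeaklyRegular_of_monic 6 _ fun i => ?_
  obtain ⟨a, ha, hai⟩ := IsIntegral.of_finite B (sectionGenerator b (some i))
  refine ⟨a, ha, ?_⟩
  rw [← Ideal.Quotient.eq_zero_iff_mem, Polynomial.aeval_def, Polynomial.hom_eval₂]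
  exact hai

theorem exact_pfDiff_section (h2 : IsUnit (2 : B)) (i : ℕ) :
    Function.Exact (pfDiff (skewMatrix (sectionEntries b)) (i + 1))
      (pfDiff (skewMatrix (sectionEntries b)) i) := by
  obtain ⟨rs, hmem, hlen, hrs⟩ := exists_isWeaklyRegular_section b
  exact exact_pfDiff_of_isWeaklyRegular (map_ofNat (C (R := B)) 2 ▸ h2.map C)
    (skewMatrix_transpose _) rs hmem hrs i (by lia)

theorem section_mem_of_C_mul_mem (h2 : IsUnit (2 : B)) {t : B} (ht : IsSMulRegular B t)
    {s : MvPolynomial (Fin 6) B}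
    (hs : C t * s ∈ pfaffianIdeal (skewMatrix (sectionEntries b))) :
    s ∈ pfaffianIdeal (skewMatrix (sectionEntries b)) := by
  let φ := Ideal.Quotient.mk (Ideal.span {t})
  have hexact := exact_pfDiff_section (φ ∘ b) (map_ofNat φ 2 ▸ h2.map φ) 0
  rw [← sectionEntries_map] at hexact
  refine (mem_pfaffianIdeal_iff_mem_range (v := fun _ => s)).2 (mem_range_of_smul_mem_range
    (MvPolynomial.map_surjective φ Ideal.Quotient.mk_surjective)
    (ker_map_eq_span_C Ideal.mk_ker) (isSMulRegular_C ht) (pfDiff_map _ _ 0) (pfDiff_map _ _ 1)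
    (pfDiff_pfDiff (map_ofNat (C (R := B)) 2 ▸ h2.map C) (skewMatrix_transpose _) 0) hexact ?_)
  exact mem_pfaffianIdeal_iff_mem_range.1 hs

end LinearSection

section GenericMatrix

theorem map_mem_pfaffianIdeal_iff {S S' : Type*} [CommRing S] [CommRing S'] {f : S →+* S'}
    (hf : Function.Surjective f) {X : Matrix (Fin 6) (Fin 6) S} {s : S} :
    f s ∈ pfaffianIdeal (f.mapMatrix X) ↔ s ∈ pfaffianIdeal X ⊔ RingHom.ker f := by
  rw [← pfaffianIdeal_map, ← Ideal.comap_map_of_surjective' f hf, Ideal.mem_comap]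

variable (K : Type*) [Field K]

/-- The ideal of Pfaffians of the generic skew-symmetric `6 × 6` matrix together with its first
entry, which defines the Schubert divisor of the Grassmannian of planes. -/
noncomputable def schubertIdeal : Ideal (MvPolynomial (Fin 15) K) :=
  pfaffianIdeal (skewMatrix X) ⊔ Ideal.span {X 0}

/-- The coordinates on the space of skew-symmetric `6 × 6` matrices in which the generic matrix is
the linear section `sectionEntries X`. -/
noncomputable def sectionCoordinates :
    MvPolynomial (Fin 15) K ≃+* MvPolynomial (Fin 6) (MvPolynomial (Fin 9) K) :=
  RingEquiv.ofRingHom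
    (aeval (sectionEntries X) : MvPolynomial (Fin 15) K →ₐ[K] _).toRingHom
    (eval₂Hom (aeval ![X 0, X 1, X 5 + X 2, X 6 + X 3, X 9 + X 4 + X 7, X 10 + X 8, X 12 + X 11,
      X 13, X 14] : MvPolynomial (Fin 9) K →ₐ[K] MvPolynomial (Fin 15) K).toRingHom
      ![X 2, X 3, X 4, X 7, X 8, X 11])
    (by
      refine MvPolynomial.ringHom_ext' (MvPolynomial.ringHom_ext' ?_ fun i => ?_) fun i => ?_
      · ext1 r; simp [MvPolynomial.algebraMap_eq]
      · fin_cases i <;> simp [sectionEntries]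
        abel
      · fin_cases i <;> simp [sectionEntries])
    (by
      refine MvPolynomial.ringHom_ext' ?_ fun i => ?_
      · ext1 r; simp [MvPolynomial.algebraMap_eq]
      · fin_cases i <;> simp [-coe_eval₂Hom, sectionEntries])

theorem sectionCoordinates_X (k : Fin 15) :
    sectionCoordinates K (X k) = sectionEntries X k := by
  simp [sectionCoordinates]

variable {K}

/-- The section coordinates followed by a substitution `φ` for the constants of the section. -/
noncomputable def sectionHom {B : Type*} [CommRing B] (φ : MvPolynomial (Fin 9) K →+* B) :
    MvPolynomial (Fin 15) K →+* MvPolynomial (Fin 6) B :=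
  (MvPolynomial.map φ).comp (sectionCoordinates K : MvPolynomial (Fin 15) K →+* _)

theorem sectionHom_mapMatrix {B : Type*} [CommRing B] (φ : MvPolynomial (Fin 9) K →+* B) :
    (sectionHom φ).mapMatrix (skewMatrix X) = skewMatrix (sectionEntries (φ ∘ X)) := by
  rw [← sectionEntries_map, skewMatrix_map, skewMatrix_map]
  exact congrArg _ (funext fun k => congrArg (MvPolynomial.map φ) (sectionCoordinates_X K k))

theorem ker_sectionHom {B : Type*} [CommRing B] {φ : MvPolynomial (Fin 9) K →+* B}
    {r : MvPolynomial (Fin 9) K} {t : MvPolynomial (Fin 15) K}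
    (hφ : RingHom.ker φ = Ideal.span {r}) (ht : sectionCoordinates K t = C r) :
    RingHom.ker (sectionHom φ) = Ideal.span {t} := by
  ext s
  rw [sectionHom, RingHom.mem_ker, RingHom.comp_apply, ← RingHom.mem_ker, ker_map_eq_span_C hφ,
    Ideal.mem_span_singleton, Ideal.mem_span_singleton, ← ht]
  exact map_dvd_iff (sectionCoordinates K)

theorem mem_sup_ker_sectionHom_of_mul_mem {B : Type*} [CommRing B] (h2 : IsUnit (2 : B))
    {φ : MvPolynomial (Fin 9) K →+* B} (hφ : Function.Surjective φ)
    {r : MvPolynomial (Fin 9) K} (hr : IsSMulRegular B (φ r)) {t s : MvPolynomial (Fin 15) K}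
    (ht : sectionCoordinates K t = C r)
    (hs : t * s ∈ pfaffianIdeal (skewMatrix X) ⊔ RingHom.ker (sectionHom φ)) :
    s ∈ pfaffianIdeal (skewMatrix X) ⊔ RingHom.ker (sectionHom φ) := by
  have hsurj : Function.Surjective (sectionHom φ) :=
    (MvPolynomial.map_surjective φ hφ).comp (sectionCoordinates K).surjective
  have hφt : sectionHom φ t = C (φ r) := by
    rw [sectionHom, RingHom.comp_apply, RingHom.coe_coe, ht, map_C]
  rw [← map_mem_pfaffianIdeal_iff hsurj, sectionHom_mapMatrix] at hs ⊢
  rw [map_mul, hφt] at hs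
  exact section_mem_of_C_mul_mem _ h2 hr hs

theorem isUnit_two_mvPolynomial (h2 : (2 : K) ≠ 0) (σ : Type*) :
    IsUnit (2 : MvPolynomial σ K) :=
  map_ofNat (C (R := K)) 2 ▸ h2.isUnit.map C

theorem generic_mem_of_X_zero_mul_mem (h2 : (2 : K) ≠ 0) {s : MvPolynomial (Fin 15) K}
    (hs : X 0 * s ∈ pfaffianIdeal (skewMatrix X)) : s ∈ pfaffianIdeal (skewMatrix X) := by
  have hker : RingHom.ker (sectionHom (K := K) (RingHom.id _)) = ⊥ := by
    have hid := (RingHom.injective_iff_ker_eq_bot (RingHom.id (MvPolynomial (Fin 9) K))).1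
      Function.injective_id
    rw [ker_sectionHom (hid.trans (Ideal.span_singleton_eq_bot.2 rfl).symm)
      ((map_zero _).trans C_0.symm), Ideal.span_singleton_eq_bot.2 rfl]
  have h := mem_sup_ker_sectionHom_of_mul_mem (t := X 0) (r := X 0) (s := s)
    (isUnit_two_mvPolynomial h2 _) (φ := RingHom.id _) Function.surjective_id
    (IsRegular.of_ne_zero (X_ne_zero 0)).left
    (sectionCoordinates_X K 0)
  rw [hker, sup_bot_eq] at h
  exact h hs

theorem schubert_mem_of_X_one_mul_mem (h2 : (2 : K) ≠ 0) {s : MvPolynomial (Fin 15) K}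
    (hs : X 1 * s ∈ schubertIdeal K) : s ∈ schubertIdeal K := by
  let φ := Ideal.Quotient.mk (Ideal.span {(X 0 : MvPolynomial (Fin 9) K)})
  have hreg : IsSMulRegular (MvPolynomial (Fin 9) K ⧸ Ideal.span {(X 0 : MvPolynomial (Fin 9) K)})
      (φ (X 1)) := by
    refine isSMulRegular_iff_right_eq_zero_of_smul.2 fun q hq => ?_
    obtain ⟨p, rfl⟩ := Ideal.Quotient.mk_surjective q
    rw [smul_eq_mul, ← map_mul, Ideal.Quotient.eq_zero_iff_mem, Ideal.mem_span_singleton] at hq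
    rw [Ideal.Quotient.eq_zero_iff_mem, Ideal.mem_span_singleton]
    exact (X_prime.dvd_or_dvd hq).resolve_left fun h => by simp [X_dvd_X] at h
  rw [schubertIdeal, ← ker_sectionHom (φ := φ) Ideal.mk_ker (sectionCoordinates_X K 0)] at hs ⊢
  exact mem_sup_ker_sectionHom_of_mul_mem
    (map_ofNat φ 2 ▸ (isUnit_two_mvPolynomial h2 _).map φ)
    Ideal.Quotient.mk_surjective hreg (sectionCoordinates_X K 1) hs

theorem exact_pfDiff_generic (h2 : (2 : K) ≠ 0) (i : ℕ) :
    Function.Exact (pfDiff (skewMatrix (X : Fin 15 → MvPolynomial (Fin 15) K)) (i + 1))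
      (pfDiff (skewMatrix X) i) := by
  obtain ⟨rs, hmem, hlen, hrs⟩ := exists_isWeaklyRegular_section (X (R := K) (σ := Fin 9))
  have hX : ((sectionCoordinates K).symm :
      MvPolynomial (Fin 6) (MvPolynomial (Fin 9) K) →+* MvPolynomial (Fin 15) K).mapMatrix
      (skewMatrix (sectionEntries X)) = skewMatrix X := by
    rw [skewMatrix_map]
    congr 1
    funext k
    rw [Function.comp_apply, RingHom.coe_coe, ← sectionCoordinates_X, RingEquiv.symm_apply_apply]
  refine exact_pfDiff_of_isWeaklyRegular (isUnit_two_mvPolynomial h2 _) (skewMatrix_transpose _)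
    (rs.map (sectionCoordinates K).symm) (fun r hr => ?_)
    ((isWeaklyRegular_map_ringEquiv (sectionCoordinates K).symm).2 hrs) i (by simp [hlen])
  obtain ⟨q, hq, rfl⟩ := List.mem_map.1 hr
  rw [← hX, ← pfaffianIdeal_map]
  exact Ideal.mem_map_of_mem _ (hmem q hq)

end GenericMatrix

/-! ## The fundamental theorems of invariant theory for `SL₂` -/

section Brackets

variable {R ι : Type*} [CommRing R]

variable (R) in
/-- The determinant of the `i`-th and the `j`-th of a family of linear forms. -/
noncomputable def bracket (i j : ι) : MvPolynomial (ι × Fin 2) R :=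
  X (i, 0) * X (j, 1) - X (i, 1) * X (j, 0)

variable (R) in
/-- The Plücker coordinates of six linear forms: their brackets, in the order of the entries of
`skewMatrix`. -/
noncomputable def plucker : Fin 15 → MvPolynomial (Fin 6 × Fin 2) R :=
  upperEntries (Matrix.of (bracket R))

theorem skewMatrix_plucker : skewMatrix (plucker R) = Matrix.of (bracket R) := by
  ext1 i j
  fin_cases i <;> fin_cases j <;>
    simp only [plucker, upperEntries, skewMatrix_apply, Matrix.of_apply, Matrix.cons_val,
      LinearMap.coe_mk, AddHom.coe_mk, bracket, Fin.zero_eta, Fin.mk_one, Fin.reduceFinMk] <;> ring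

theorem pfAdj_bracket : pfAdj (Matrix.of (bracket R (ι := Fin 6))) = 0 := by
  have h : blockPfaffian (Matrix.of (bracket R (ι := Fin 6))) = 0 := by
    funext a b c d
    simp only [blockPfaffian, Matrix.of_apply, bracket, Pi.zero_apply]
    ring
  rw [pfAdj, h, ← zero_smul R (0 : Fin 6 → Fin 6 → Fin 6 → Fin 6 → MvPolynomial (Fin 6 × Fin 2) R)]
  simpa using skewComplement_smul (0 : MvPolynomial (Fin 6 × Fin 2) R) 0

theorem aeval_plucker_eq_zero {f : MvPolynomial (Fin 15) R}
    (hf : f ∈ pfaffianIdeal (skewMatrix X)) : aeval (plucker R) f = 0 := by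
  have h := Ideal.mem_map_of_mem (aeval (plucker R) : MvPolynomial (Fin 15) R →ₐ[R] _).toRingHom hf
  have hX : (aeval (plucker R) : MvPolynomial (Fin 15) R →ₐ[R] _).toRingHom ∘ X = plucker R :=
    funext fun k => aeval_X _ k
  rw [pfaffianIdeal_map, skewMatrix_map, hX, skewMatrix_plucker, pfaffianIdeal, pfAdj_bracket,
    map_zero] at h
  simpa using h

theorem eval_aeval_plucker (c : Fin 6 × Fin 2 → R) (f : MvPolynomial (Fin 15) R) :
    eval c (aeval (plucker R) f) = eval (eval c ∘ plucker R) f := by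
  rw [map_aeval, algebraMap_eq]
  congr 2
  ext r
  simp

end Brackets

section Elimination

variable {R σ : Type*} [CommRing R] {J : Ideal (MvPolynomial σ R)} {t : σ} {s : Set σ}

theorem X_mem_supported_of_mem (ht : t ∈ s) : (X t : MvPolynomial σ R) ∈ supported R s := by
  rw [supported_eq_adjoin_X]
  exact Algebra.subset_adjoin ⟨t, ht, rfl⟩

theorem exists_pow_mul_sub_mem (ht : t ∈ s)
    (h : ∀ k, k ∉ s → ∃ g ∈ supported R s, X t * X k - g ∈ J) (f : MvPolynomial σ R) :
    ∃ n : ℕ, ∃ g ∈ supported R s, X t ^ n * f - g ∈ J := by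
  have hX : (X t : MvPolynomial σ R) ∈ supported R s := X_mem_supported_of_mem ht
  induction f using MvPolynomial.induction_on with
  | C r => exact ⟨0, C r, (supported R s).algebraMap_mem r, by simp⟩
  | add p q hp hq =>
    obtain ⟨n, g, hg, hn⟩ := hp
    obtain ⟨m, g', hg', hm⟩ := hq
    refine ⟨n + m, X t ^ m * g + X t ^ n * g', add_mem (mul_mem (pow_mem hX m) hg)
      (mul_mem (pow_mem hX n) hg'), ?_⟩
    convert J.add_mem (J.mul_mem_left (X t ^ m) hn) (J.mul_mem_left (X t ^ n) hm) using 1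
    ring
  | mul_X p k hp =>
    obtain ⟨n, g, hg, hn⟩ := hp
    by_cases hk : k ∈ s
    · refine ⟨n, g * X k, mul_mem hg (X_mem_supported_of_mem hk), ?_⟩
      convert J.mul_mem_right (X k) hn using 1
      ring
    · obtain ⟨g', hg', hm⟩ := h k hk
      refine ⟨n + 1, g * g', mul_mem hg hg', ?_⟩
      convert J.add_mem (J.mul_mem_right (X t * X k) hn) (J.mul_mem_left g hm) using 1
      ring

theorem eval_eq_of_mem_supported {g : MvPolynomial σ R} (hg : g ∈ supported R s) {c d : σ → R}
    (h : ∀ k ∈ s, c k = d k) : eval c g = eval d g :=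
  eval₂Hom_congr' rfl (fun i hi _ => h i (mem_supported.1 hg hi)) rfl

variable [IsDomain R] [Infinite R]

theorem eq_zero_of_forall_ne_zero_eval_eq_zero {g : MvPolynomial σ R}
    (h : ∀ c : σ → R, c t ≠ 0 → eval c g = 0) : g = 0 := by
  have hXg : X t * g = 0 := by
    refine MvPolynomial.funext fun c => ?_
    by_cases hc : c t = 0
    · simp [hc]
    · simp [h c hc]
  exact (mul_eq_zero.1 hXg).resolve_left (X_ne_zero t)

-- Where `X t ≠ 0` the zero set of `J` is the graph of a function of the coordinates in `s`, so
-- that a polynomial in these coordinates that vanishes on it is zero.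
theorem mem_of_forall_eval_eq_zero (ht : t ∈ s)
    (h : ∀ k, k ∉ s → ∃ g ∈ supported R s, X t * X k - g ∈ J)
    (hreg : ∀ p, X t * p ∈ J → p ∈ J) {P : Set (σ → R)} (hP : ∀ d ∈ P, ∀ p ∈ J, eval d p = 0)
    (hsurj : ∀ c : σ → R, c t ≠ 0 → ∃ d ∈ P, ∀ k ∈ s, d k = c k) {f : MvPolynomial σ R}
    (hf : ∀ d ∈ P, eval d f = 0) : f ∈ J := by
  obtain ⟨n, g, hg, hn⟩ := exists_pow_mul_sub_mem ht h f
  have hg0 : g = 0 := by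
    refine eq_zero_of_forall_ne_zero_eval_eq_zero (t := t) fun c hc => ?_
    obtain ⟨d, hd, hdc⟩ := hsurj c hc
    have hdg := hP d hd _ hn
    rw [map_sub, map_mul, hf d hd, mul_zero, zero_sub, neg_eq_zero] at hdg
    rw [← eval_eq_of_mem_supported hg hdc, hdg]
  rw [hg0, sub_zero] at hn
  induction n with
  | zero => simpa using hn
  | succ n ih => exact ih (hreg _ (by rwa [← mul_assoc, ← pow_succ']))

end Elimination

section PluckerRelations

variable {R : Type*} [CommRing R]

theorem pfAdj_apply_mem_pfaffianIdeal (M : Matrix (Fin 6) (Fin 6) R) (i j : Fin 6) :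
    pfAdj M i j ∈ pfaffianIdeal M := by
  have h (k : Fin 15) : upperEntries (pfAdj M) k ∈ pfaffianIdeal M := Ideal.subset_span ⟨k, rfl⟩
  have hM : pfAdj M = skewMatrix (upperEntries (pfAdj M)) := by
    rw [pfAdj, skewComplement, upperEntries_skewMatrix]
  rw [hM]
  generalize upperEntries (pfAdj M) = y at h
  fin_cases i <;> fin_cases j <;>
    simp only [skewMatrix_apply, Matrix.of_apply, Matrix.cons_val, Fin.zero_eta, Fin.mk_one,
      Fin.reduceFinMk, neg_mem_iff, h, zero_mem]

theorem exists_mem_supported_of_relation {σ : Type*} {J : Ideal (MvPolynomial σ R)} {s : Set σ}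
    {p : MvPolynomial σ R} {a b c d : σ} (h : p - X a * X b + X c * X d ∈ J) (ha : a ∈ s)
    (hb : b ∈ s) (hc : c ∈ s) (hd : d ∈ s) : ∃ g ∈ supported R s, p - g ∈ J :=
  ⟨X a * X b - X c * X d,
    sub_mem (mul_mem (X_mem_supported_of_mem ha) (X_mem_supported_of_mem hb))
      (mul_mem (X_mem_supported_of_mem hc) (X_mem_supported_of_mem hd)),
    by rwa [← sub_add]⟩

theorem exists_mem_supported_pfaffianIdeal {k : Fin 15}
    (hk : k ∉ ({0, 1, 2, 3, 4, 5, 6, 7, 8} : Set (Fin 15))) :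
    ∃ g ∈ supported R ({0, 1, 2, 3, 4, 5, 6, 7, 8} : Set (Fin 15)),
      X 0 * X k - g ∈ pfaffianIdeal (skewMatrix (X : Fin 15 → MvPolynomial (Fin 15) R)) := by
  have hk' : k = 9 ∨ k = 10 ∨ k = 11 ∨ k = 12 ∨ k = 13 ∨ k = 14 := by
    simp only [Set.mem_insert_iff, Set.mem_singleton_iff] at hk
    revert k
    decide
  have h := pfAdj_apply_mem_pfaffianIdeal (skewMatrix (X : Fin 15 → MvPolynomial (Fin 15) R))
  rcases hk' with rfl | rfl | rfl | rfl | rfl | rfl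
  · exact exists_mem_supported_of_relation (a := 1) (b := 6) (c := 2) (d := 5)
      (neg_mem_iff.1 (h 4 5)) (by simp) (by simp) (by simp) (by simp)
  · exact exists_mem_supported_of_relation (a := 1) (b := 7) (c := 3) (d := 5)
      (h 3 5) (by simp) (by simp) (by simp) (by simp)
  · exact exists_mem_supported_of_relation (a := 1) (b := 8) (c := 4) (d := 5)
      (neg_mem_iff.1 (h 3 4)) (by simp) (by simp) (by simp) (by simp)
  · exact exists_mem_supported_of_relation (a := 2) (b := 7) (c := 3) (d := 6)
      (neg_mem_iff.1 (h 2 5)) (by simp) (by simp) (by simp) (by simp)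
  · exact exists_mem_supported_of_relation (a := 2) (b := 8) (c := 4) (d := 6)
      (h 2 4) (by simp) (by simp) (by simp) (by simp)
  · exact exists_mem_supported_of_relation (a := 3) (b := 8) (c := 4) (d := 7)
      (neg_mem_iff.1 (h 2 3)) (by simp) (by simp) (by simp) (by simp)

theorem exists_mem_supported_schubertIdeal {K : Type*} [Field K] {k : Fin 15}
    (hk : k ∉ ({1, 2, 3, 4, 5, 9, 10, 11} : Set (Fin 15))) :
    ∃ g ∈ supported K ({1, 2, 3, 4, 5, 9, 10, 11} : Set (Fin 15)),
      X 1 * X k - g ∈ schubertIdeal K := by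
  have hk' : k = 0 ∨ k = 6 ∨ k = 7 ∨ k = 8 ∨ k = 12 ∨ k = 13 ∨ k = 14 := by
    simp only [Set.mem_insert_iff, Set.mem_singleton_iff] at hk
    revert k
    decide
  have h (i j) : pfAdj (skewMatrix (X : Fin 15 → MvPolynomial (Fin 15) K)) i j ∈ schubertIdeal K :=
    Ideal.mem_sup_left (pfAdj_apply_mem_pfaffianIdeal _ i j)
  have hX (p) : X 0 * p ∈ schubertIdeal K :=
    Ideal.mul_mem_right _ _ (Ideal.mem_sup_right (Ideal.mem_span_singleton_self _))
  have mem_of_relation {a b c d : Fin 15}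
      (habcd : X 0 * X a - X 1 * X b + X c * X d ∈ schubertIdeal K)
      (hc : c ∈ ({1, 2, 3, 4, 5, 9, 10, 11} : Set (Fin 15)))
      (hd : d ∈ ({1, 2, 3, 4, 5, 9, 10, 11} : Set (Fin 15))) :
      ∃ g ∈ supported K ({1, 2, 3, 4, 5, 9, 10, 11} : Set (Fin 15)),
        X 1 * X b - g ∈ schubertIdeal K := by
    refine ⟨X c * X d, mul_mem (X_mem_supported_of_mem hc) (X_mem_supported_of_mem hd), ?_⟩
    convert sub_mem (hX (X a)) habcd using 1
    ring
  rcases hk' with rfl | rfl | rfl | rfl | rfl | rfl | rfl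
  · exact ⟨0, zero_mem _, by simpa [mul_comm] using hX (X 1)⟩
  · exact mem_of_relation (a := 9) (c := 2) (d := 5) (neg_mem_iff.1 (h 4 5)) (by simp) (by simp)
  · exact mem_of_relation (a := 10) (c := 3) (d := 5) (h 3 5) (by simp) (by simp)
  · exact mem_of_relation (a := 11) (c := 4) (d := 5) (neg_mem_iff.1 (h 3 4)) (by simp) (by simp)
  · exact exists_mem_supported_of_relation (a := 2) (b := 10) (c := 3) (d := 9)
      (h 1 5) (by simp) (by simp) (by simp) (by simp)
  · exact exists_mem_supported_of_relation (a := 2) (b := 11) (c := 4) (d := 9)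
      (neg_mem_iff.1 (h 1 4)) (by simp) (by simp) (by simp) (by simp)
  · exact exists_mem_supported_of_relation (a := 3) (b := 11) (c := 4) (d := 10)
      (h 1 3) (by simp) (by simp) (by simp) (by simp)

end PluckerRelations

section Relations

variable {K : Type*} [Field K]

theorem bracket_zero_one_ne_zero : bracket K (0 : Fin 6) 1 ≠ 0 := by
  intro h0
  have h1 := congrArg
    (eval fun a : Fin 6 × Fin 2 => !![1, 0; 0, 1; 0, 0; 0, 0; 0, 0; 0, 0] a.1 a.2) h0
  simp [bracket] at h1

variable [Infinite K]

theorem aeval_plucker_eq_zero_iff (h2 : (2 : K) ≠ 0) {f : MvPolynomial (Fin 15) K} :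
    aeval (plucker K) f = 0 ↔ f ∈ pfaffianIdeal (skewMatrix X) := by
  refine ⟨fun hf => ?_, aeval_plucker_eq_zero⟩
  refine mem_of_forall_eval_eq_zero (P := Set.range fun v => eval v ∘ plucker K) (by simp)
    (fun _ => exists_mem_supported_pfaffianIdeal) (fun _ => generic_mem_of_X_zero_mul_mem h2)
    ?_ (fun c hc => ?_) ?_
  · rintro _ ⟨v, rfl⟩ p hp
    rw [← eval_aeval_plucker, aeval_plucker_eq_zero hp, map_zero]
  · let v : Fin 6 × Fin 2 → K := fun a =>
      !![1, 0; 0, c 0; -c 5 / c 0, c 1; -c 6 / c 0, c 2; -c 7 / c 0, c 3; -c 8 / c 0, c 4] a.1 a.2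
    refine ⟨_, ⟨v, rfl⟩, ?_⟩
    rintro k (rfl | rfl | rfl | rfl | rfl | rfl | rfl | rfl | rfl) <;>
      simp [plucker, upperEntries, bracket, v] <;> field_simp
  · rintro _ ⟨v, rfl⟩
    rw [← eval_aeval_plucker, hf, map_zero]

theorem mem_schubertIdeal_of_bracket_dvd (h2 : (2 : K) ≠ 0) {f : MvPolynomial (Fin 15) K}
    (hf : bracket K 0 1 ∣ aeval (plucker K) f) : f ∈ schubertIdeal K := by
  refine mem_of_forall_eval_eq_zero
    (P := (fun v => eval v ∘ plucker K) '' {v | eval v (bracket K 0 1) = 0}) (by simp)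
    (fun _ => exists_mem_supported_schubertIdeal) (fun _ => schubert_mem_of_X_one_mul_mem h2)
    ?_ (fun c hc => ?_) ?_
  · rintro _ ⟨v, hv, rfl⟩ p hp
    obtain ⟨q, hq, r, hr, rfl⟩ := Submodule.mem_sup.1 hp
    obtain ⟨r, rfl⟩ := Ideal.mem_span_singleton.1 hr
    rw [← eval_aeval_plucker, map_add, aeval_plucker_eq_zero hq, zero_add, map_mul, aeval_X,
      map_mul]
    exact mul_eq_zero_of_left hv _
  · let v : Fin 6 × Fin 2 → K := fun a =>
      !![1, 0; c 5 / c 1, 0; 0, c 1; -c 9 / c 1, c 2; -c 10 / c 1, c 3; -c 11 / c 1, c 4] a.1 a.2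
    refine ⟨_, ⟨v, by simp [bracket, v], rfl⟩, ?_⟩
    rintro k (rfl | rfl | rfl | rfl | rfl | rfl | rfl | rfl) <;>
      simp [plucker, upperEntries, bracket, v] <;> field_simp
  · rintro _ ⟨v, hv, rfl⟩
    obtain ⟨q, hq⟩ := hf
    rw [← eval_aeval_plucker, hq, map_mul, show eval v (bracket K 0 1) = 0 from hv, zero_mul]

theorem exists_aeval_plucker_eq_of_bracket_mul (h2 : (2 : K) ≠ 0)
    {h : MvPolynomial (Fin 6 × Fin 2) K} {f : MvPolynomial (Fin 15) K}
    (hf : bracket K 0 1 * h = aeval (plucker K) f) :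
    ∃ f' : MvPolynomial (Fin 15) K, h = aeval (plucker K) f' := by
  obtain ⟨p, hp, q, hq, rfl⟩ :=
    Submodule.mem_sup.1 (mem_schubertIdeal_of_bracket_dvd h2 ⟨h, hf.symm⟩)
  obtain ⟨f', rfl⟩ := Ideal.mem_span_singleton.1 hq
  rw [map_add, aeval_plucker_eq_zero hp, zero_add, map_mul, aeval_X] at hf
  exact ⟨f', mul_left_cancel₀ bracket_zero_one_ne_zero hf⟩

end Relations

section Invariants

variable {K : Type u} [Field K] {n : ℕ}

theorem linearForm_eq (p : BinaryForm K 1) : (p : MvPolynomial (Fin 2) K) =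
    C (coeff (Finsupp.single 0 1) (p : MvPolynomial (Fin 2) K)) * X 0 +
      C (coeff (Finsupp.single 1 1) (p : MvPolynomial (Fin 2) K)) * X 1 := by
  obtain ⟨c, hc⟩ := (Submodule.mem_span_range_iff_exists_fun K).1
    (homogeneousSubmodule_one_eq_span_X.le p.2)
  rw [← hc]
  simp [Fin.sum_univ_two, smul_eq_C_mul, coeff_C_mul, coeff_X, Finsupp.single_left_inj]

theorem linearFormsCoord_act (g : Matrix.SpecialLinearGroup (Fin 2) K)
    (v : Fin n → BinaryForm K 1) : linearFormsCoord (fun i => BinaryForm.act g (v i)) =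
      fun a =>
        linearFormsCoord v (a.1, 0) * g⁻¹ 0 a.2 + linearFormsCoord v (a.1, 1) * g⁻¹ 1 a.2 := by
  funext ⟨i, j⟩
  simp only [linearFormsCoord, BinaryForm.act]
  conv_lhs => rw [linearForm_eq (v i)]
  fin_cases j <;>
    simp [coeff_C_mul, coeff_X, Finsupp.single_left_inj, mul_add, algebraMap_eq]

theorem linearFormsCoord_surjective :
    Function.Surjective (linearFormsCoord : (Fin n → BinaryForm K 1) → Fin n × Fin 2 → K) := by
  intro c
  refine ⟨fun i => ⟨C (c (i, 0)) * X 0 + C (c (i, 1)) * X 1, (mem_homogeneousSubmodule 1 _).2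
    ((isHomogeneous_C_mul_X _ _).add (isHomogeneous_C_mul_X _ _))⟩, ?_⟩
  funext ⟨i, j⟩
  fin_cases j <;> simp [linearFormsCoord, coeff_C_mul, coeff_X, Finsupp.single_left_inj]

theorem mem_linearFormsInvariants_iff {h : MvPolynomial (Fin n × Fin 2) K} :
    h ∈ linearFormsInvariants K n ↔ ∀ (g : Matrix.SpecialLinearGroup (Fin 2) K) c,
      eval (fun a => c (a.1, 0) * g 0 a.2 + c (a.1, 1) * g 1 a.2) h = eval c h := by
  refine ⟨fun hh g c => ?_, fun hh g v => ?_⟩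
  · obtain ⟨v, rfl⟩ := linearFormsCoord_surjective c
    have := hh g⁻¹ v
    rwa [linearFormsCoord_act, inv_inv] at this
  · rw [linearFormsCoord_act, hh]

theorem bracket_mem_linearFormsInvariants (i j : Fin n) :
    bracket K i j ∈ linearFormsInvariants K n := by
  refine mem_linearFormsInvariants_iff.2 fun g c => ?_
  have hdet := g.det_coe
  rw [Matrix.det_fin_two] at hdet
  simp only [bracket, map_sub, map_mul, eval_X]
  linear_combination (c (i, 0) * c (j, 1) - c (i, 1) * c (j, 0)) * hdet

theorem plucker_mem_linearFormsInvariants (k : Fin 15) :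
    plucker K k ∈ linearFormsInvariants K 6 := by
  fin_cases k <;> exact bracket_mem_linearFormsInvariants _ _

theorem aeval_plucker_skewMatrix (i j : Fin 6) :
    aeval (plucker K) (skewMatrix (X : Fin 15 → MvPolynomial (Fin 15) K) i j) = bracket K i j := by
  have h := skewMatrix_map (aeval (plucker K) : MvPolynomial (Fin 15) K →ₐ[K] _).toRingHom X
  have hX : (aeval (plucker K) : MvPolynomial (Fin 15) K →ₐ[K] _).toRingHom ∘ X = plucker K :=
    funext fun k => aeval_X _ k
  rw [hX, skewMatrix_plucker] at h
  exact congrFun (congrFun h i) j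

/-- The coordinates of six linear forms after a unimodular change of variables that makes the
first two of them `X 0` and `[01] X 1`, expressed through the brackets of the forms. -/
noncomputable def normalizedCoord (c : Fin 6 × Fin 2 → K) (a : Fin 6 × Fin 2) : K :=
  if a.2 = 0 then eval c (bracket K a.1 1) / eval c (bracket K 0 1) else eval c (bracket K 0 a.1)

theorem eval_normalizedCoord {h : MvPolynomial (Fin 6 × Fin 2) K}
    (hh : h ∈ linearFormsInvariants K 6) {c : Fin 6 × Fin 2 → K}
    (hc : eval c (bracket K 0 1) ≠ 0) : eval (normalizedCoord c) h = eval c h := by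
  have hc' : c (0, 0) * c (1, 1) - c (0, 1) * c (1, 0) ≠ 0 := by simpa [bracket] using hc
  let g : Matrix.SpecialLinearGroup (Fin 2) K :=
    ⟨!![c (1, 1) / (c (0, 0) * c (1, 1) - c (0, 1) * c (1, 0)), -c (0, 1);
      -c (1, 0) / (c (0, 0) * c (1, 1) - c (0, 1) * c (1, 0)), c (0, 0)], by
      rw [Matrix.det_fin_two_of, div_mul_eq_mul_div, neg_mul, mul_div_assoc', neg_div', ← sub_div,
        div_eq_one_iff_eq hc']
      ring⟩
  rw [← mem_linearFormsInvariants_iff.1 hh g c]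
  congr 2
  funext ⟨i, j⟩
  fin_cases j
  · simp [normalizedCoord, g, bracket]
    field_simp
    ring
  · simp [normalizedCoord, g, bracket]
    ring

theorem exists_pow_mul_eval_normalizedCoord_eq (h : MvPolynomial (Fin 6 × Fin 2) K) :
    ∃ (n : ℕ) (F : MvPolynomial (Fin 15) K), ∀ c : Fin 6 × Fin 2 → K, eval c (bracket K 0 1) ≠ 0 →
      eval c (bracket K 0 1) ^ n * eval (normalizedCoord c) h = eval c (aeval (plucker K) F) := by
  have h01 : plucker K 0 = bracket K 0 1 := rfl
  induction h using MvPolynomial.induction_on with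
  | C r => exact ⟨0, C r, fun c _ => by simp [algebraMap_eq]⟩
  | add p q hp hq =>
    obtain ⟨n, F, hF⟩ := hp
    obtain ⟨m, G, hG⟩ := hq
    refine ⟨n + m, X 0 ^ m * F + X 0 ^ n * G, fun c hc => ?_⟩
    simp only [map_add, map_mul, map_pow, aeval_X, h01, ← hF c hc, ← hG c hc]
    ring
  | mul_X p a hp =>
    obtain ⟨n, F, hF⟩ := hp
    refine ⟨n + 1, F * if a.2 = 0 then skewMatrix X a.1 1 else X 0 * skewMatrix X 0 a.1,
      fun c hc => ?_⟩
    rw [map_mul, map_mul, map_mul, ← hF c hc, eval_X, normalizedCoord]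
    generalize eval _ p = P
    split_ifs with ha
    · rw [aeval_plucker_skewMatrix]
      field_simp
      ring
    · rw [map_mul, aeval_plucker_skewMatrix, aeval_X, map_mul, h01]
      ring

theorem exists_aeval_plucker_eq [Infinite K] (h2 : (2 : K) ≠ 0)
    {h : MvPolynomial (Fin 6 × Fin 2) K} (hh : h ∈ linearFormsInvariants K 6) :
    ∃ f : MvPolynomial (Fin 15) K, h = aeval (plucker K) f := by
  obtain ⟨n, F, hF⟩ := exists_pow_mul_eval_normalizedCoord_eq h
  have key : bracket K 0 1 ^ n * h = aeval (plucker K) F := by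
    refine mul_left_cancel₀ bracket_zero_one_ne_zero (MvPolynomial.funext fun c => ?_)
    by_cases hc : eval c (bracket K 0 1) = 0
    · rw [map_mul, map_mul _ (bracket K 0 1), hc, zero_mul, zero_mul]
    · rw [map_mul, map_mul _ (bracket K 0 1), ← hF c hc, map_mul, map_pow,
        eval_normalizedCoord hh hc]
  clear hF
  induction n generalizing F with
  | zero => exact ⟨F, by simpa using key⟩
  | succ n ih =>
    rw [pow_succ', mul_assoc] at key
    obtain ⟨F', hF'⟩ := exists_aeval_plucker_eq_of_bracket_mul h2 key
    exact ih F' hF'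

end Invariants

/-! ## Minimal homogeneous generators -/

section LinearSubstitution

variable {R ι κ B : Type*}

theorem aeval_linearCombination_X [CommSemiring R] [CommSemiring B] [Algebra R B]
    (l : (ι →₀ R) →ₗ[R] B) (x : ι →₀ R) :
    aeval (R := R) (fun i => l (Finsupp.single i 1)) (Finsupp.linearCombination R X x) = l x := by
  have h : (aeval (R := R) fun i => l (Finsupp.single i 1)).toLinearMap ∘ₗ
      Finsupp.linearCombination R (X : ι → MvPolynomial ι R) = l :=
    Finsupp.lhom_ext' fun i => LinearMap.ext_ring (by simp)
  exact LinearMap.congr_fun h x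

theorem isHomogeneous_linearCombination_X [CommSemiring R] (x : ι →₀ R) :
    (Finsupp.linearCombination R (X : ι → MvPolynomial ι R) x).IsHomogeneous 1 := by
  rw [← mem_homogeneousSubmodule, homogeneousSubmodule_one_eq_span_X,
    ← Finsupp.range_linearCombination]
  exact ⟨x, rfl⟩

/-- The isomorphism of polynomial rings induced by an isomorphism between the spaces of linear
forms, which are encoded by their coefficients. -/
noncomputable def linearSubstitution [CommSemiring R] (e : (ι →₀ R) ≃ₗ[R] (κ →₀ R)) :
    MvPolynomial ι R ≃ₐ[R] MvPolynomial κ R :=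
  AlgEquiv.ofAlgHom
    (aeval fun i => (Finsupp.linearCombination R X ∘ₗ e.toLinearMap) (Finsupp.single i 1))
    (aeval fun k => (Finsupp.linearCombination R X ∘ₗ e.symm.toLinearMap) (Finsupp.single k 1))
    (algHom_ext fun k => by
      rw [AlgHom.comp_apply, aeval_X, LinearMap.comp_apply, aeval_linearCombination_X]
      simp)
    (algHom_ext fun i => by
      rw [AlgHom.comp_apply, aeval_X, LinearMap.comp_apply, aeval_linearCombination_X]
      simp)

theorem linearSubstitution_X [CommSemiring R] (e : (ι →₀ R) ≃ₗ[R] (κ →₀ R)) (i : ι) :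
    linearSubstitution e (X i) = Finsupp.linearCombination R X (e (Finsupp.single i 1)) :=
  aeval_X _ i

theorem linearSubstitution_symm_X [CommSemiring R] (e : (ι →₀ R) ≃ₗ[R] (κ →₀ R)) (k : κ) :
    (linearSubstitution e).symm (X k) =
      Finsupp.linearCombination R X (e.symm (Finsupp.single k 1)) :=
  aeval_X _ k

theorem exists_algEquiv_of_span_range_eq [CommRing R] [CommRing B] [Algebra R B] {f : ι → B}
    {g : κ → B} (hf : LinearIndependent R f) (hg : LinearIndependent R g)
    (hfg : Submodule.span R (Set.range f) = Submodule.span R (Set.range g)) :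
    ∃ Θ : MvPolynomial ι R ≃ₐ[R] MvPolynomial κ R,
      (∀ r, aeval f r = aeval g (Θ r)) ∧ ∀ k, (Θ.symm (X k)).IsHomogeneous 1 := by
  let e : (ι →₀ R) ≃ₗ[R] (κ →₀ R) :=
    hf.linearCombinationEquiv ≪≫ₗ LinearEquiv.ofEq _ _ hfg ≪≫ₗ hg.linearCombinationEquiv.symm
  have he (x) : Finsupp.linearCombination R g (e x) = Finsupp.linearCombination R f x :=
    hg.linearCombination_repr _
  refine ⟨linearSubstitution e, fun r => ?_, fun k => ?_⟩
  · refine DFunLike.congr_fun (f := aeval f) (g := (aeval g).comp (linearSubstitution e).toAlgHom)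
      (algHom_ext fun i => ?_) r
    have hg' : aeval (R := R) g =
        aeval fun k => Finsupp.linearCombination R g (Finsupp.single k 1) := by
      simp
    calc aeval f (X i) = Finsupp.linearCombination R g (e (Finsupp.single i 1)) := by simp [he]
      _ = aeval g (linearSubstitution e (X i)) := by
        rw [linearSubstitution_X, hg', aeval_linearCombination_X]
  · rw [linearSubstitution_symm_X]
    exact isHomogeneous_linearCombination_X _

end LinearSubstitution

section HomogeneousGenerators

variable {K : Type*} [Field K] {ι τ : Type*} {g : ι → MvPolynomial τ K} {w : ι → ℕ}
  {x : MvPolynomial τ K} {d n : ℕ}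

theorem mem_span_monomials_of_isHomogeneous (hg : ∀ i, (g i).IsHomogeneous (w i))
    (hx : x ∈ Algebra.adjoin K (Set.range g)) (hn : x.IsHomogeneous n) :
    x ∈ Submodule.span K
      ((fun s : ι →₀ ℕ => s.prod fun i k => g i ^ k) '' {s | Finsupp.weight w s = n}) := by
  classical
  rw [Algebra.adjoin_range_eq_range_aeval] at hx
  obtain ⟨P, hP : aeval g P = x⟩ := hx
  have hhom (s : ι →₀ ℕ) :
      (s.prod fun i k => g i ^ k).IsHomogeneous (Finsupp.weight w s) := by
    rw [Finsupp.weight_apply]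
    refine IsHomogeneous.prod _ _ _ fun i _ => ?_
    simpa only [smul_eq_mul, mul_comm] using (hg i).pow (s i)
  rw [← homogeneousComponent_eq_self hn, ← hP, P.as_sum, map_sum, map_sum]
  refine Submodule.sum_mem _ fun s _ => ?_
  rw [aeval_monomial, algebraMap_eq, homogeneousComponent_C_mul, ← smul_eq_C_mul,
    homogeneousComponent_of_mem (hhom s)]
  refine Submodule.smul_mem _ _ ?_
  split_ifs with h
  · exact Submodule.subset_span ⟨s, h.symm, rfl⟩
  · exact zero_mem _

theorem exists_eq_single_of_weight_eq (hd : d ≠ 0) (hw : ∀ i, d ≤ w i) {s : ι →₀ ℕ}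
    (h : Finsupp.weight w s = d) : ∃ i, w i = d ∧ s = Finsupp.single i 1 := by
  obtain ⟨i, hi⟩ : ∃ i, s i ≠ 0 := by
    by_contra! h0
    exact hd (by rw [← h, show s = 0 from Finsupp.ext h0, map_zero])
  have hsum := Finsupp.weight_sub_single_add (w := w) hi
  have hs : s - Finsupp.single i 1 = 0 := by
    by_contra h0
    obtain ⟨j, hj⟩ := Finsupp.ne_iff.1 h0
    have hwj := Finsupp.le_weight_of_ne_zero' w hj
    have hi' := hw i
    have hj' := hw j
    omega
  refine ⟨i, by simpa [hs, h] using hsum, ?_⟩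
  rw [← Finsupp.sub_add_single_one_cancel hi, hs, zero_add]

theorem mem_span_of_isHomogeneous_of_le (hd : d ≠ 0) (hg : ∀ i, (g i).IsHomogeneous (w i))
    (hw : ∀ i, d ≤ w i) (hx : x ∈ Algebra.adjoin K (Set.range g)) (hxd : x.IsHomogeneous d) :
    x ∈ Submodule.span K (g '' {i | w i = d}) := by
  refine Submodule.span_mono ?_ (mem_span_monomials_of_isHomogeneous hg hx hxd)
  rintro _ ⟨s, hs, rfl⟩
  obtain ⟨i, hi, rfl⟩ := exists_eq_single_of_weight_eq hd hw hs
  exact ⟨i, hi, by simp⟩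

theorem mem_span_range_of_isHomogeneous (hd : d ≠ 0) (hg : ∀ i, (g i).IsHomogeneous d)
    (hx : x ∈ Algebra.adjoin K (Set.range g)) (hxd : x.IsHomogeneous d) :
    x ∈ Submodule.span K (Set.range g) :=
  Submodule.span_mono (Set.image_subset_range _ _)
    (mem_span_of_isHomogeneous_of_le (w := fun _ => d) hd hg (fun _ => le_rfl) hx hxd)

theorem mem_adjoin_empty_of_isHomogeneous_of_lt (hg : ∀ i, (g i).IsHomogeneous d)
    (hx : x ∈ Algebra.adjoin K (Set.range g)) (hn : x.IsHomogeneous n) (hnd : n < d) :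
    x ∈ Algebra.adjoin K (∅ : Set (MvPolynomial τ K)) := by
  refine (Submodule.span_le (p := Subalgebra.toSubmodule (Algebra.adjoin K ∅))).2 ?_
    (mem_span_monomials_of_isHomogeneous (w := fun _ => d) hg hx hn)
  rintro _ ⟨s, hs, rfl⟩
  have hs0 : s = 0 := by
    ext k
    by_contra hk
    have hle := Finsupp.le_weight_of_ne_zero' (fun _ : ι => d) hk
    have hs' : Finsupp.weight (fun _ : ι => d) s = n := hs
    omega
  rw [hs0]
  exact one_mem (Algebra.adjoin K (∅ : Set (MvPolynomial τ K)))

end HomogeneousGenerators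

theorem adjoin_image_eq_top_iff {R B ι : Type*} [CommSemiring R] [Semiring B] [Algebra R B]
    {A : Subalgebra R B} (f : ι → A) (S : Set ι) :
    Algebra.adjoin R (f '' S) = ⊤ ↔ A ≤ Algebra.adjoin R ((fun i => (f i : B)) '' S) := by
  have hle : Algebra.adjoin R ((fun i => (f i : B)) '' S) ≤ A :=
    Algebra.adjoin_le (by rintro _ ⟨i, -, rfl⟩; exact (f i).2)
  rw [← (Subalgebra.map_injective (f := A.val) Subtype.val_injective).eq_iff, AlgHom.map_adjoin,
    Set.image_image, Algebra.map_top, Subalgebra.range_val]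
  exact ⟨fun h => h.ge, fun h => hle.antisymm h⟩

section MinimalGenerators

variable {K : Type u} [Field K] {τ : Type} {A : Subalgebra K (MvPolynomial τ K)} {d m : ℕ}

theorem isMinimalHomogeneousGenerators_of_linearIndependent {f : Fin m → A} (hd : d ≠ 0)
    (hf : ∀ i, (f i : MvPolynomial τ K).IsHomogeneous d)
    (hli : LinearIndependent K fun i => (f i : MvPolynomial τ K))
    (hA : A ≤ Algebra.adjoin K (Set.range fun i => (f i : MvPolynomial τ K))) :
    IsMinimalHomogeneousGenerators A (fun _ => d) f where
  homogeneous := hf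
  generates := by rwa [← Set.image_univ, adjoin_image_eq_top_iff, Set.image_univ]
  minimal S hS := by
    rw [adjoin_image_eq_top_iff, Set.image_eq_range] at hS
    refine Set.eq_univ_iff_forall.2 fun i => by_contra fun hi => hli.notMem_span_image hi ?_
    rw [Set.image_eq_range]
    exact mem_span_range_of_isHomogeneous hd (fun j : S => hf j) (hS (f i).2) (hf i)

variable {w : Fin m → ℕ} {f : Fin m → A} (hf : IsMinimalHomogeneousGenerators A w f)
include hf

theorem IsMinimalHomogeneousGenerators.le_adjoin :
    A ≤ Algebra.adjoin K (Set.range fun i => (f i : MvPolynomial τ K)) := by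
  rw [← Set.image_univ, ← adjoin_image_eq_top_iff, Set.image_univ, hf.generates]

theorem IsMinimalHomogeneousGenerators.notMem_adjoin_compl (i : Fin m) :
    (f i : MvPolynomial τ K) ∉
      Algebra.adjoin K ((fun i => (f i : MvPolynomial τ K)) '' {i}ᶜ) := by
  intro hi
  have hle : A ≤ Algebra.adjoin K ((fun i => (f i : MvPolynomial τ K)) '' {i}ᶜ) := by
    refine hf.le_adjoin.trans (Algebra.adjoin_le ?_)
    rintro _ ⟨j, rfl⟩
    obtain rfl | hj := eq_or_ne j i
    · exact hi
    · exact Algebra.subset_adjoin ⟨j, hj, rfl⟩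
  have huniv := hf.minimal {i}ᶜ ((adjoin_image_eq_top_iff f _).2 hle)
  exact (huniv ▸ Set.mem_univ i : i ∈ ({i}ᶜ : Set (Fin m))) rfl

theorem IsMinimalHomogeneousGenerators.linearIndependent :
    LinearIndependent K fun i => (f i : MvPolynomial τ K) := by
  rw [linearIndependent_iff_notMem_span]
  intro i hi
  rw [← Set.compl_eq_univ_sdiff] at hi
  exact hf.notMem_adjoin_compl i (Algebra.span_le_adjoin K _ hi)

variable {ι : Type*} {g : ι → MvPolynomial τ K} (hg : ∀ i, (g i).IsHomogeneous d)
  (hA : Algebra.adjoin K (Set.range g) = A)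
include hg hA

theorem IsMinimalHomogeneousGenerators.le_weight (i : Fin m) : d ≤ w i := by
  by_contra! hw
  exact hf.notMem_adjoin_compl i (Algebra.adjoin_mono (Set.empty_subset _)
    (mem_adjoin_empty_of_isHomogeneous_of_lt hg (hA ▸ (f i).2) (hf.homogeneous i) hw))

theorem IsMinimalHomogeneousGenerators.mem_span_image (hd : d ≠ 0) (k : ι) :
    g k ∈ Submodule.span K ((fun i => (f i : MvPolynomial τ K)) '' {i | w i = d}) :=
  mem_span_of_isHomogeneous_of_le hd hf.homogeneous (hf.le_weight hg hA)
    (hf.le_adjoin (hA.le (Algebra.subset_adjoin ⟨k, rfl⟩))) (hg k)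

theorem IsMinimalHomogeneousGenerators.weight_eq (hd : d ≠ 0) (i : Fin m) : w i = d := by
  have hle : A ≤ Algebra.adjoin K ((fun i => (f i : MvPolynomial τ K)) '' {i | w i = d}) := by
    refine hA.ge.trans (Algebra.adjoin_le ?_)
    rintro _ ⟨k, rfl⟩
    exact Algebra.span_le_adjoin K _ (hf.mem_span_image hg hA hd k)
  have huniv := hf.minimal _ ((adjoin_image_eq_top_iff f _).2 hle)
  exact (huniv ▸ Set.mem_univ i : i ∈ {i | w i = d})

theorem IsMinimalHomogeneousGenerators.span_range_eq (hd : d ≠ 0) :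
    Submodule.span K (Set.range fun i => (f i : MvPolynomial τ K)) =
      Submodule.span K (Set.range g) := by
  refine le_antisymm (Submodule.span_le.2 ?_) (Submodule.span_le.2 ?_)
  · rintro _ ⟨i, rfl⟩
    exact mem_span_range_of_isHomogeneous hd hg (hA ▸ (f i).2)
      (hf.weight_eq hg hA hd i ▸ hf.homogeneous i)
  · rintro _ ⟨k, rfl⟩
    exact Submodule.span_mono (Set.image_subset_range _ _) (hf.mem_span_image hg hA hd k)

end MinimalGenerators

section PluckerGenerators

variable {K : Type u} [Field K]

theorem plucker_isHomogeneous {R : Type*} [CommRing R] (k : Fin 15) :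
    (plucker R k).IsHomogeneous 2 := by
  have h (i j : Fin 6) : (bracket R i j).IsHomogeneous 2 :=
    ((isHomogeneous_X R _).mul (isHomogeneous_X R _)).sub
      ((isHomogeneous_X R _).mul (isHomogeneous_X R _))
  fin_cases k <;> exact h _ _

theorem linearIndependent_plucker {R : Type*} [CommRing R] : LinearIndependent R (plucker R) := by
  rw [Fintype.linearIndependent_iff]
  intro a ha
  have h (i j : Fin 6) : eval (fun p : Fin 6 × Fin 2 => if p = (i, 0) ∨ p = (j, 1) then 1 else 0)
      (∑ k, a k • plucker R k) = 0 := by rw [ha, map_zero]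
  simp only [Fin.sum_univ_succ, plucker, upperEntries, LinearMap.coe_mk, AddHom.coe_mk,
    Matrix.of_apply, bracket] at h
  intro k
  fin_cases k
  exacts [by simpa using h 0 1, by simpa using h 0 2, by simpa using h 0 3, by simpa using h 0 4,
    by simpa using h 0 5, by simpa using h 1 2, by simpa using h 1 3, by simpa using h 1 4,
    by simpa using h 1 5, by simpa using h 2 3, by simpa using h 2 4, by simpa using h 2 5,
    by simpa using h 3 4, by simpa using h 3 5, by simpa using h 4 5]

theorem adjoin_plucker [Infinite K] (h2 : (2 : K) ≠ 0) :
    Algebra.adjoin K (Set.range (plucker K)) = linearFormsInvariants K 6 := by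
  refine le_antisymm (Algebra.adjoin_le ?_) fun h hh => ?_
  · rintro _ ⟨k, rfl⟩
    exact plucker_mem_linearFormsInvariants k
  · obtain ⟨F, rfl⟩ := exists_aeval_plucker_eq h2 hh
    rw [Algebra.adjoin_range_eq_range_aeval]
    exact ⟨F, rfl⟩

theorem isMinimalHomogeneousGenerators_plucker [Infinite K] (h2 : (2 : K) ≠ 0) :
    IsMinimalHomogeneousGenerators (linearFormsInvariants K 6) (fun _ : Fin 15 => 2)
      (fun k => ⟨plucker K k, plucker_mem_linearFormsInvariants k⟩) :=
  isMinimalHomogeneousGenerators_of_linearIndependent two_ne_zero plucker_isHomogeneous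
    linearIndependent_plucker (adjoin_plucker h2).ge

end PluckerGenerators

/-! ## Graded minimality and projective dimension -/

section Grading

/-- The internal degrees of the basis elements of the terms of the Pfaffian complex, when the
entries of the matrix have degree `2`. -/
def pfDegree : ∀ i, PfTerm i → ℕ
  | 0 => fun _ => 0
  | 1 => fun _ => 4
  | 2 => fun _ => 6
  | 3 => Sum.elim (fun _ => 8) (fun _ => 10)
  | 4 => fun _ => 12
  | 5 => fun _ => 14
  | 6 => fun _ => 18
  | _ + 7 => Empty.elim

section MatrixEntries

variable {S A : Type*} [CommRing S] [SetLike A S] {N : A} {Z : Matrix (Fin 6) (Fin 6) S}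

theorem upperEntries_apply_mem (hZ : ∀ i j, Z i j ∈ N) (a : Fin 15) : upperEntries Z a ∈ N := by
  fin_cases a <;> exact hZ _ _

variable [AddSubgroupClass A S]

theorem skewMatrix_apply_mem {c : Fin 15 → S} (hc : ∀ a, c a ∈ N) (i j : Fin 6) :
    skewMatrix c i j ∈ N := by
  fin_cases i <;> fin_cases j <;> first
    | exact hc _
    | exact neg_mem (hc _)
    | exact zero_mem _

theorem pfAdj_apply_mem {X : Matrix (Fin 6) (Fin 6) S}
    (h : ∀ a b c d, blockPfaffian X a b c d ∈ N) (i j : Fin 6) : pfAdj X i j ∈ N :=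
  skewMatrix_apply_mem (fun a => by fin_cases a <;> simp [h]) i j

theorem zeroCornerMatrix_apply_mem {c : NonCorner → S} (hc : ∀ a, c a ∈ N) (i j : Fin 6) :
    zeroCornerMatrix c i j ∈ N := by
  change (if h : (i, j) = (5, 5) then 0 else c ⟨(i, j), h⟩) ∈ N
  split_ifs
  · exact zero_mem _
  · exact hc _

theorem trace_mem (hZ : ∀ i j, Z i j ∈ N) : trace Z ∈ N :=
  sum_mem fun i _ => hZ i i

theorem tracelessMatrix_apply_mem {c : NonCorner → S} (hc : ∀ a, c a ∈ N) (i j : Fin 6) :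
    tracelessMatrix c i j ∈ N := by
  rw [tracelessMatrix_apply, Matrix.sub_apply, single_apply]
  refine sub_mem (zeroCornerMatrix_apply_mem hc i j) ?_
  split_ifs
  · exact trace_mem (zeroCornerMatrix_apply_mem hc)
  · exact zero_mem _

theorem modScalars_apply_mem (hZ : ∀ i j, Z i j ∈ N) (i j : Fin 6) : modScalars Z i j ∈ N := by
  rw [modScalars_apply, Matrix.sub_apply, Matrix.smul_apply, one_apply, smul_ite, smul_zero,
    smul_eq_mul, mul_one]
  refine sub_mem (hZ i j) ?_
  split_ifs
  · exact hZ 5 5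
  · exact zero_mem _

end MatrixEntries

variable {S : Type*} [CommRing S] {σ : Type*} {w : σ → ℕ} {k d n : ℕ}

variable (S w k n) in
/-- The component of degree `n` of the graded module `R(-k)`, where `R` is the polynomial ring in
which the variable `X i` has degree `w i`. -/
noncomputable def shiftedComponent : Submodule S (MvPolynomial σ S) :=
  restrictSupport S {s | Finsupp.weight w s + k = n}

theorem mem_shiftedComponent_iff {p : MvPolynomial σ S} :
    p ∈ shiftedComponent S w k n ↔ ∀ s, coeff s p ≠ 0 → Finsupp.weight w s + k = n := by
  simp only [shiftedComponent, mem_restrictSupport_iff, Set.subset_def, Finset.mem_coe,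
    mem_support_iff, Set.mem_ofPred_eq]

theorem mul_mem_shiftedComponent {p q : MvPolynomial σ S} (hp : p ∈ shiftedComponent S w (k + d) n)
    (hq : IsWeightedHomogeneous w q d) : p * q ∈ shiftedComponent S w k n := by
  rw [← mem_weightedHomogeneousSubmodule, weightedHomogeneousSubmodule_eq_finsupp_supported] at hq
  refine restrictSupport_mono S ?_ (restrictSupport_add S _ _ ▸ Submodule.mul_mem_mul hp hq)
  rintro _ ⟨s, hs, t, ht, rfl⟩
  simp only [Set.mem_ofPred_eq, map_add] at hs ht ⊢
  lia

variable {Z W : Matrix (Fin 6) (Fin 6) (MvPolynomial σ S)}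

theorem mul_homogeneous_apply_mem (hZ : ∀ i j, Z i j ∈ shiftedComponent S w (k + d) n)
    (hW : ∀ i j, IsWeightedHomogeneous w (W i j) d) (i j : Fin 6) :
    (Z * W) i j ∈ shiftedComponent S w k n := by
  rw [Matrix.mul_apply]
  exact sum_mem fun l _ => mul_mem_shiftedComponent (hZ i l) (hW l j)

theorem homogeneous_mul_apply_mem (hZ : ∀ i j, Z i j ∈ shiftedComponent S w (k + d) n)
    (hW : ∀ i j, IsWeightedHomogeneous w (W i j) d) (i j : Fin 6) :
    (W * Z) i j ∈ shiftedComponent S w k n := by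
  rw [Matrix.mul_apply]
  exact sum_mem fun l _ => mul_comm (W i l) _ ▸ mul_mem_shiftedComponent (hZ l j) (hW i l)

variable {X : Matrix (Fin 6) (Fin 6) (MvPolynomial σ S)}

theorem isWeightedHomogeneous_pfAdj (hX : ∀ i j, IsWeightedHomogeneous w (X i j) 2) (i j : Fin 6) :
    IsWeightedHomogeneous w (pfAdj X i j) 4 :=
  pfAdj_apply_mem (N := weightedHomogeneousSubmodule S w 4) (fun a b c e =>
    add_mem (sub_mem ((hX a b).mul (hX c e)) ((hX a c).mul (hX b e))) ((hX a e).mul (hX b c))) i j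

theorem polarPfaffian_skewMatrix_mem (hX : ∀ i j, IsWeightedHomogeneous w (X i j) 2)
    {c : Fin 15 → MvPolynomial σ S} (hc : ∀ a, c a ∈ shiftedComponent S w (k + 4) n) :
    polarPfaffian X (skewMatrix c) ∈ shiftedComponent S w k n := by
  rw [polarPfaffian_skewMatrix]
  exact neg_mem <| sum_mem fun a _ => mul_mem_shiftedComponent (hc a) <|
    upperEntries_apply_mem (N := weightedHomogeneousSubmodule S w 4)
      (isWeightedHomogeneous_pfAdj hX) a

theorem pfDiff_apply_mem_shiftedComponent (hX : ∀ i j, IsWeightedHomogeneous w (X i j) 2) :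
    ∀ (i : ℕ) (v : PfTerm (i + 1) → MvPolynomial σ S),
      (∀ a, v a ∈ shiftedComponent S w (pfDegree (i + 1) a) n) →
      ∀ a, pfDiff X i v a ∈ shiftedComponent S w (pfDegree i a) n
  | 0, _, hv, _ => polarPfaffian_skewMatrix_mem hX (k := 0) hv
  | 1, v, hv, a => by
    have hv' := tracelessMatrix_apply_mem (N := shiftedComponent S w 6 n) hv
    exact upperEntries_apply_mem (fun i j => add_mem
      (mul_homogeneous_apply_mem (k := 4) (d := 2) hv' hX i j)
      (homogeneous_mul_apply_mem (k := 4) (d := 2) (fun i j => hv' j i) hX i j)) a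
  | 2, v, hv, a => add_mem
    (homogeneous_mul_apply_mem (Z := symmMatrix (v ∘ Sum.inl)) (k := 6) (d := 2)
      (fun i j => hv (Sum.inl s(i, j))) hX _ _)
    (mul_homogeneous_apply_mem (Z := symmMatrix (v ∘ Sum.inr)) (k := 6) (d := 4)
      (fun i j => hv (Sum.inr s(i, j))) (isWeightedHomogeneous_pfAdj hX) _ _)
  | 3, v, hv, Sum.inl a => by
    have hv' := zeroCornerMatrix_apply_mem (N := shiftedComponent S w 12 n) hv
    have hY := isWeightedHomogeneous_pfAdj hX
    exact sub_mem
      (homogeneous_mul_apply_mem (k := 8) (d := 4) (fun i j => hv' j i) hY _ _)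
      (mul_homogeneous_apply_mem (k := 8) (d := 4) hv' hY _ _)
  | 3, v, hv, Sum.inr a => by
    have hv' := zeroCornerMatrix_apply_mem (N := shiftedComponent S w 12 n) hv
    exact sub_mem (homogeneous_mul_apply_mem (k := 10) (d := 2) hv' hX _ _)
      (mul_homogeneous_apply_mem (k := 10) (d := 2) (fun i j => hv' j i) hX _ _)
  | 4, v, hv, a => modScalars_apply_mem (mul_homogeneous_apply_mem (k := 12) (d := 2)
      (skewMatrix_apply_mem hv) hX) _ _
  | 5, v, hv, a => mul_mem_shiftedComponent (k := 14) (d := 4) (hv ()) <|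
      upperEntries_apply_mem (N := weightedHomogeneousSubmodule S w 4)
        (isWeightedHomogeneous_pfAdj hX) a
  | _ + 6, _, _, _ => zero_mem _

end Grading

section Shifts

theorem exists_equiv_replicate_append {α β : Type} [Fintype α] [Fintype β] {p q : ℕ} (x y : ℕ)
    (hα : Fintype.card α = p) (hβ : Fintype.card β = q) :
    ∃ e : Fin (List.replicate p x ++ List.replicate q y).length ≃ α ⊕ β,
      ∀ a, Sum.elim (fun _ => x) (fun _ => y) (e a) =
        (List.replicate p x ++ List.replicate q y).get a := by
  let e₀ : Fin p ⊕ Fin q ≃ Fin (List.replicate p x ++ List.replicate q y).length :=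
    finSumFinEquiv.trans (finCongr (by simp))
  refine ⟨e₀.symm.trans
    ((Fintype.equivFinOfCardEq hα).symm.sumCongr (Fintype.equivFinOfCardEq hβ).symm), fun a => ?_⟩
  obtain ⟨b | b, rfl⟩ := e₀.surjective a
  · simp [e₀]
  · simp [e₀]

theorem exists_equiv_replicate {α : Type} [Fintype α] {p : ℕ} (x : ℕ) (hα : Fintype.card α = p) :
    ∃ e : Fin (List.replicate p x).length ≃ α,
      ∀ a, Function.const α x (e a) = (List.replicate p x).get a :=
  ⟨(finCongr List.length_replicate).trans (Fintype.equivFinOfCardEq hα).symm,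
    fun _ => (List.getElem_replicate _).symm⟩

theorem exists_equiv_pfTerm : ∀ i, ∃ e : Fin (sixLinearFormsShifts i).length ≃ PfTerm i,
    ∀ a, pfDegree i (e a) = (sixLinearFormsShifts i).get a
  | 0 => exists_equiv_replicate (α := Unit) (p := 1) 0 rfl
  | 1 => exists_equiv_replicate (α := Fin 15) 4 (Fintype.card_fin 15)
  | 2 => exists_equiv_replicate (α := NonCorner) 6 (by decide)
  | 3 => by
    have h : Fintype.card (Sym2 (Fin 6)) = 21 := by
      rw [Sym2.card, Fintype.card_fin]
      rfl
    exact exists_equiv_replicate_append 8 10 h h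
  | 4 => exists_equiv_replicate (α := NonCorner) 12 (by decide)
  | 5 => exists_equiv_replicate (α := Fin 15) 14 (Fintype.card_fin 15)
  | 6 => exists_equiv_replicate (α := Unit) (p := 1) 18 rfl
  | _ + 7 => ⟨Equiv.equivOfIsEmpty (Fin 0) Empty, fun a => Fin.elim0 a⟩

theorem get_sixLinearFormsShifts_ne (i : ℕ) (a : Fin (sixLinearFormsShifts (i + 1)).length)
    (b : Fin (sixLinearFormsShifts i).length) :
    (sixLinearFormsShifts i).get b ≠ (sixLinearFormsShifts (i + 1)).get a := by
  have h : ∀ (i : ℕ), ∀ x ∈ sixLinearFormsShifts (i + 1), ∀ y ∈ sixLinearFormsShifts i, y ≠ x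
    | 0 | 1 | 2 | 3 | 4 | 5 | _ + 6 => by simp [sixLinearFormsShifts]
  exact h i _ (List.get_mem _ _) _ (List.get_mem _ _)

end Shifts

section Minimality

theorem mem_smul_top_pi_iff {R ι : Type*} [CommRing R] [Finite ι] {I : Ideal R} {v : ι → R} :
    v ∈ I • (⊤ : Submodule R (ι → R)) ↔ ∀ i, v i ∈ I := by
  have := Fintype.ofFinite ι
  refine ⟨fun hv i => ?_, fun hv => ?_⟩
  · have h := Submodule.mem_map_of_mem (f := LinearMap.proj i) hv
    rw [Submodule.map_smul''] at h
    exact Ideal.mul_le_left h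
  · classical
    rw [pi_eq_sum_univ' v]
    exact sum_mem fun i _ => Submodule.smul_mem_smul (hv i) trivial

variable {K : Type u} [Field K] {σ : Type} {w : σ → ℕ}

theorem mem_span_range_X_iff {p : MvPolynomial σ K} :
    p ∈ Ideal.span (Set.range (X : σ → MvPolynomial σ K)) ↔ coeff 0 p = 0 := by
  rw [← Set.image_univ, mem_ideal_span_X_image]
  refine ⟨fun h => ?_, fun h s hs => ?_⟩
  · by_contra h0
    obtain ⟨i, -, hi⟩ := h 0 (mem_support_iff.2 h0)
    exact hi rfl
  · by_contra! hs0
    obtain rfl : s = 0 := Finsupp.ext fun i => hs0 i (Set.mem_univ i)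
    exact mem_support_iff.1 hs h

theorem range_le_of_isDegree {e e' : List ℕ}
    (f : ShiftedFree K σ e →ₗ[MvPolynomial σ K] ShiftedFree K σ e')
    (he : ∀ a b, e'.get b ≠ e.get a) (hf : ∀ n v, IsDegree w n v → IsDegree w n (f v)) :
    LinearMap.range f ≤ Ideal.span (Set.range (X : σ → MvPolynomial σ K)) •
      (⊤ : Submodule (MvPolynomial σ K) (ShiftedFree K σ e')) := by
  classical
  rintro _ ⟨v, rfl⟩
  rw [pi_eq_sum_univ' v, map_sum]
  refine sum_mem fun a _ => ?_
  rw [map_smul]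
  refine Submodule.smul_mem _ _ <| mem_smul_top_pi_iff.2 fun b => mem_span_range_X_iff.2 ?_
  have hdeg : IsDegree w (e.get a) (Pi.single a 1 : ShiftedFree K σ e) := by
    intro a' s hs
    obtain rfl | h := eq_or_ne a' a
    · rw [Pi.single_eq_same, coeff_one] at hs
      rw [← (ite_ne_right_iff.1 hs).1, map_zero, zero_add]
    · rw [Pi.single_eq_of_ne h, coeff_zero] at hs
      exact absurd rfl hs
  by_contra h0
  exact he a b (by simpa only [map_zero, zero_add] using hf _ _ hdeg b 0 h0)

end Minimality

section ProjectiveDimension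

open CategoryTheory

variable {R : Type u} [CommRing R]

theorem hasProjectiveDimensionLT_iff_ker {F N : Type u} [AddCommGroup F] [Module R F]
    [AddCommGroup N] [Module R N] [Module.Projective R F] {f : F →ₗ[R] N}
    (hf : Function.Surjective f) (n : ℕ) :
    HasProjectiveDimensionLT (ModuleCat.of R N) (n + 2) ↔
      HasProjectiveDimensionLT (ModuleCat.of R (LinearMap.ker f)) (n + 1) := by
  have hS : (ShortComplex.mk (ModuleCat.ofHom (LinearMap.ker f).subtype) (ModuleCat.ofHom f)
      (by ext x; exact x.2)).ShortExact :=
    { exact := (ShortComplex.ShortExact.moduleCat_exact_iff_function_exact _).2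
        (LinearMap.exact_subtype_ker_map f)
      mono_f := (ModuleCat.mono_iff_injective _).2 Subtype.val_injective
      epi_g := (ModuleCat.epi_iff_surjective _).2 hf }
  exact hS.hasProjectiveDimensionLT_X₃_iff n
    ((IsProjective.iff_projective F).1 inferInstance)

theorem hasProjectiveDimensionLT_one_iff_projective {N : Type u} [AddCommGroup N] [Module R N] :
    HasProjectiveDimensionLT (ModuleCat.of R N) 1 ↔ Module.Projective R N := by
  rw [← projective_iff_hasProjectiveDimensionLT_one, IsProjective.iff_projective]

theorem exists_leftInverse_of_projective_range {M N P : Type*} [AddCommGroup M] [Module R M]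
    [AddCommGroup N] [Module R N] [AddCommGroup P] [Module R P] {f : M →ₗ[R] N} {g : N →ₗ[R] P}
    (hf : Function.Injective f) (hfg : Function.Exact f g)
    [Module.Projective R (LinearMap.range g)] :
    ∃ ρ : N →ₗ[R] M, ρ ∘ₗ f = LinearMap.id := by
  have hfg' : Function.Exact f g.rangeRestrict := fun x => by
    rw [← hfg x, Subtype.ext_iff]
    rfl
  have hsection := Module.projective_lifting_property g.rangeRestrict LinearMap.id
    (LinearMap.surjective_rangeRestrict g)
  have hsplit := hfg'.split_tfae'.out 0 1
  exact (hsplit.1 (And.intro hf hsection)).2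

theorem smul_top_eq_top_of_leftInverse {M N : Type*} [AddCommGroup M] [Module R M]
    [AddCommGroup N] [Module R N] {I : Ideal R} {f : M →ₗ[R] N} {ρ : N →ₗ[R] M}
    (hρ : ρ ∘ₗ f = LinearMap.id) (hf : LinearMap.range f ≤ I • (⊤ : Submodule R N)) :
    I • (⊤ : Submodule R M) = ⊤ := by
  rw [eq_top_iff]
  calc ⊤ = (LinearMap.range f).map ρ := by rw [← LinearMap.range_comp, hρ, LinearMap.range_id]
    _ ≤ (I • ⊤ : Submodule R N).map ρ := Submodule.map_mono hf
    _ = I • (⊤ : Submodule R N).map ρ := Submodule.map_smul'' _ _ _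
    _ ≤ I • ⊤ := Submodule.smul_mono le_rfl le_top

variable {M : Type u} [AddCommGroup M] [Module R M] {F : ℕ → Type u} [∀ i, AddCommGroup (F i)]
  [∀ i, Module R (F i)] [∀ i, Module.Projective R (F i)] {d : ∀ i, F (i + 1) →ₗ[R] F i}
  {ε : F 0 →ₗ[R] M}

theorem hasProjectiveDimensionLT_iff_range (hε : Function.Surjective ε)
    (h₀ : Function.Exact (d 0) ε) (hd : ∀ i, Function.Exact (d (i + 1)) (d i)) (i : ℕ) :
    ∀ k, HasProjectiveDimensionLT (ModuleCat.of R M) (k + 2 + i) ↔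
      HasProjectiveDimensionLT (ModuleCat.of R (LinearMap.range (d i))) (k + 1) := by
  induction i with
  | zero =>
    intro k
    rw [← h₀.linearMap_ker_eq]
    exact hasProjectiveDimensionLT_iff_ker hε k
  | succ i ih =>
    intro k
    rw [show k + 2 + (i + 1) = k + 1 + 2 + i by lia, ih (k + 1), ← (hd i).linearMap_ker_eq,
      ← LinearMap.ker_rangeRestrict (d i)]
    exact hasProjectiveDimensionLT_iff_ker (LinearMap.surjective_rangeRestrict (d i)) k

theorem hasProjectiveDimensionLT_iff_projective_range (hε : Function.Surjective ε)
    (h₀ : Function.Exact (d 0) ε) (hd : ∀ i, Function.Exact (d (i + 1)) (d i)) (i : ℕ) :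
    HasProjectiveDimensionLT (ModuleCat.of R M) (i + 2) ↔
      Module.Projective R (LinearMap.range (d i)) := by
  rw [← hasProjectiveDimensionLT_one_iff_projective, add_comm i, ← zero_add 2]
  exact hasProjectiveDimensionLT_iff_range hε h₀ hd i 0

theorem projectiveDimension_eq_of_minimal (hε : Function.Surjective ε)
    (h₀ : Function.Exact (d 0) ε) (hd : ∀ i, Function.Exact (d (i + 1)) (d i)) {n : ℕ}
    [Subsingleton (F (n + 3))] {I : Ideal R} (hI : I • (⊤ : Submodule R (F (n + 2))) ≠ ⊤)
    (hmin : LinearMap.range (d (n + 1)) ≤ I • (⊤ : Submodule R (F (n + 1)))) :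
    projectiveDimension (ModuleCat.of R M) = (n + 2 : ℕ) := by
  have hinj : Function.Injective (d (n + 1)) := by
    rw [← LinearMap.ker_eq_bot, (hd (n + 1)).linearMap_ker_eq, LinearMap.range_eq_bot]
    exact Subsingleton.elim _ _
  refine le_antisymm ?_ ?_
  · rw [projectiveDimension_le_iff]
    exact (hasProjectiveDimensionLT_iff_projective_range hε h₀ hd (n + 1)).2 <|
      .of_equiv (LinearEquiv.ofInjective _ hinj)
  · rw [projectiveDimension_ge_iff, hasProjectiveDimensionLT_iff_projective_range hε h₀ hd]
    intro hproj
    obtain ⟨ρ, hρ⟩ := exists_leftInverse_of_projective_range hinj (hd n)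
    exact hI (smul_top_eq_top_of_leftInverse hρ hmin)

end ProjectiveDimension

section RingEquiv

variable {S S' : Type*} [CommRing S] [CommRing S'] (e : S ≃+* S') {X : Matrix (Fin 6) (Fin 6) S}

theorem exact_pfDiff_map_ringEquiv_iff (i : ℕ) :
    Function.Exact (pfDiff ((e : S →+* S').mapMatrix X) (i + 1))
      (pfDiff ((e : S →+* S').mapMatrix X) i) ↔
      Function.Exact (pfDiff X (i + 1)) (pfDiff X i) := by
  let E (j : ℕ) : (PfTerm j → S) ≃+ (PfTerm j → S') := AddEquiv.piCongrRight fun _ => e.toAddEquiv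
  have h (j) : (pfDiff ((e : S →+* S').mapMatrix X) j).toAddMonoidHom.comp
      (E (j + 1)).toAddMonoidHom = (E j).toAddMonoidHom.comp (pfDiff X j).toAddMonoidHom :=
    AddMonoidHom.ext fun v => (pfDiff_map (e : S →+* S') X j v).symm
  exact Function.Exact.iff_of_ladder_addEquiv (E (i + 2)) (E (i + 1)) (E i) (h (i + 1)) (h i)

theorem map_ringEquiv_mem_pfaffianIdeal_iff {s : S} :
    e s ∈ pfaffianIdeal ((e : S →+* S').mapMatrix X) ↔ s ∈ pfaffianIdeal X := by
  have h := map_mem_pfaffianIdeal_iff (f := (e : S →+* S')) e.surjective (X := X) (s := s)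
  rwa [RingHom.ker_coe_equiv, sup_bot_eq] at h

end RingEquiv

section Reindexing

/-- A bijection between the summands of the shifted free modules and the standard bases of the
terms of the Pfaffian complex which matches the degrees. -/
noncomputable def shiftEquiv (i : ℕ) : Fin (sixLinearFormsShifts i).length ≃ PfTerm i :=
  (exists_equiv_pfTerm i).choose

theorem pfDegree_shiftEquiv {i : ℕ} (a : Fin (sixLinearFormsShifts i).length) :
    pfDegree i (shiftEquiv i a) = (sixLinearFormsShifts i).get a :=
  (exists_equiv_pfTerm i).choose_spec a

variable {S : Type*} [CommRing S] (X : Matrix (Fin 6) (Fin 6) S) (i : ℕ)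

/-- The differential of the Pfaffian complex, the basis of each term being numbered as in
`sixLinearFormsShifts`. -/
noncomputable def shiftedPfDiff :
    (Fin (sixLinearFormsShifts (i + 1)).length → S) →ₗ[S]
      (Fin (sixLinearFormsShifts i).length → S) :=
  LinearMap.funLeft S S (shiftEquiv i) ∘ₗ pfDiff X i ∘ₗ
    LinearMap.funLeft S S (shiftEquiv (i + 1)).symm

variable {X i}

theorem shiftedPfDiff_apply (v : Fin (sixLinearFormsShifts (i + 1)).length → S) :
    shiftedPfDiff X i v = pfDiff X i (v ∘ (shiftEquiv (i + 1)).symm) ∘ shiftEquiv i :=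
  rfl

theorem shiftedPfDiff_eq_zero_iff {v : Fin (sixLinearFormsShifts (i + 1)).length → S} :
    shiftedPfDiff X i v = 0 ↔ pfDiff X i (v ∘ (shiftEquiv (i + 1)).symm) = 0 := by
  rw [shiftedPfDiff_apply, ← Equiv.eq_comp_symm]
  rfl

theorem mem_range_shiftedPfDiff_iff {v : Fin (sixLinearFormsShifts i).length → S} :
    v ∈ LinearMap.range (shiftedPfDiff X i) ↔
      v ∘ (shiftEquiv i).symm ∈ LinearMap.range (pfDiff X i) := by
  simp only [LinearMap.mem_range, shiftedPfDiff_apply, ← Equiv.eq_comp_symm]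
  exact (((shiftEquiv (i + 1)).arrowCongr (.refl S)).surjective.exists
    (p := fun c => pfDiff X i c = v ∘ (shiftEquiv i).symm)).symm

theorem exact_shiftedPfDiff (h : Function.Exact (pfDiff X (i + 1)) (pfDiff X i)) :
    Function.Exact (shiftedPfDiff X (i + 1)) (shiftedPfDiff X i) := fun _ =>
  shiftedPfDiff_eq_zero_iff.trans <| (h _).trans mem_range_shiftedPfDiff_iff.symm

theorem mem_range_shiftedPfDiff_zero_iff {v : Fin (sixLinearFormsShifts 0).length → S} :
    v ∈ LinearMap.range (shiftedPfDiff X 0) ↔ v (0 : Fin 1) ∈ pfaffianIdeal X := by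
  have h : v ((shiftEquiv 0).symm ()) = v (0 : Fin 1) :=
    congrArg v (Subsingleton.elim (α := Fin 1) _ _)
  rw [← h]
  exact mem_range_shiftedPfDiff_iff.trans mem_pfaffianIdeal_iff_mem_range.symm

end Reindexing

section Homogeneity

theorem isWeightedHomogeneous_of_isHomogeneous_one {R σ : Type*} [CommSemiring R] {w : σ → ℕ}
    {k : ℕ} (hw : ∀ i, w i = k) {p : MvPolynomial σ R} (hp : p.IsHomogeneous 1) :
    IsWeightedHomogeneous w p k := by
  intro s hs
  have h := hp hs
  simp only [Finsupp.weight_apply, Finsupp.sum, Pi.one_apply, smul_eq_mul, mul_one] at h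
  simp only [Finsupp.weight_apply, Finsupp.sum, hw, smul_eq_mul, ← Finset.sum_mul, h, one_mul]

theorem isHomogeneous_aeval_of_isWeightedHomogeneous {R σ τ : Type*} [CommSemiring R] {w : σ → ℕ}
    {n : ℕ} {g : σ → MvPolynomial τ R} (hg : ∀ i, (g i).IsHomogeneous (w i))
    {p : MvPolynomial σ R} (hp : IsWeightedHomogeneous w p n) : (aeval g p).IsHomogeneous n := by
  rw [aeval_def, eval₂_eq]
  refine IsHomogeneous.sum _ _ _ fun s hs => ?_
  have h : (∏ i ∈ s.support, g i ^ s i).IsHomogeneous (∑ i ∈ s.support, w i * s i) :=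
    IsHomogeneous.prod _ _ _ fun i _ => (hg i).pow _
  rw [algebraMap_eq, ← hp (mem_support_iff.1 hs), Finsupp.weight_apply, Finsupp.sum]
  simp only [smul_eq_mul, mul_comm (s _)]
  exact h.C_mul _

end Homogeneity

section Resolution

variable {K : Type u} [Field K] {σ τ : Type} {w : σ → ℕ}
  {A : Subalgebra K (MvPolynomial τ K)} {φ : MvPolynomial σ K →ₐ[K] A}
  {Y : Matrix (Fin 6) (Fin 6) (MvPolynomial σ K)}

theorem isDegree_shiftedPfDiff
    (hY : ∀ i j, IsWeightedHomogeneous w (Y i j) 2) (i n : ℕ)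
    (v : ShiftedFree K σ (sixLinearFormsShifts (i + 1))) (hv : IsDegree w n v) :
    IsDegree w n (e := sixLinearFormsShifts i) (shiftedPfDiff Y i v) := by
  intro a
  rw [← pfDegree_shiftEquiv a]
  refine mem_shiftedComponent_iff.1 (pfDiff_apply_mem_shiftedComponent hY i _ (fun b => ?_) _)
  obtain ⟨b, rfl⟩ := (shiftEquiv (i + 1)).surjective b
  rw [LinearMap.funLeft_apply, Equiv.symm_apply_apply, pfDegree_shiftEquiv]
  exact mem_shiftedComponent_iff.2 (hv b)

/-- The minimal free resolution given by the Pfaffian complex of `Y`, for a graded quotient of the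
polynomial ring by the ideal of the Pfaffians of order `4` of `Y`. -/
noncomputable def pfaffianResolution (hφ : Function.Surjective φ)
    (hφw : ∀ n p, IsWeightedHomogeneous w p n → (φ p : MvPolynomial τ K).IsHomogeneous n)
    (hY : ∀ i j, IsWeightedHomogeneous w (Y i j) 2)
    (hexact : ∀ i, Function.Exact (pfDiff Y (i + 1)) (pfDiff Y i))
    (hker : ∀ r, φ r = 0 ↔ r ∈ pfaffianIdeal Y) :
    MinimalGradedFreeResolution w A φ sixLinearFormsShifts where
  d := shiftedPfDiff Y
  ε := (φ : MvPolynomial σ K →+* A).toSemilinearMap.comp (LinearMap.proj (0 : Fin 1))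
  d_graded := isDegree_shiftedPfDiff hY
  ε_graded n _ hv := hφw n _ fun s hs => hv (0 : Fin 1) s hs
  ε_surjective a := (hφ a).imp' (fun r _ => r) fun _ hr => hr
  exact_zero _ := (hker _).trans mem_range_shiftedPfDiff_zero_iff.symm
  exact_succ i := exact_shiftedPfDiff (hexact i)
  minimal i := range_le_of_isDegree _ (get_sixLinearFormsShifts_ne i) (isDegree_shiftedPfDiff hY i)

theorem homologicalDimension_eq_six
    (F : MinimalGradedFreeResolution w A φ sixLinearFormsShifts) :
    homologicalDimension (φ : MvPolynomial σ K →+* A) = 6 := by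
  let : Module (MvPolynomial σ K) A := Module.compHom _ (φ : MvPolynomial σ K →+* A)
  let ε : ShiftedFree K σ (sixLinearFormsShifts 0) →ₗ[MvPolynomial σ K] A :=
    { toFun := F.ε
      map_add' := map_add F.ε
      map_smul' := F.ε.map_smulₛₗ }
  have : Subsingleton (ShiftedFree K σ (sixLinearFormsShifts 7)) :=
    inferInstanceAs (Subsingleton (Fin 0 → MvPolynomial σ K))
  have hI : Ideal.span (Set.range X) •
      (⊤ : Submodule (MvPolynomial σ K) (ShiftedFree K σ (sixLinearFormsShifts 6))) ≠
        ⊤ := fun h => by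
    have h1 := mem_smul_top_pi_iff.1 (h ▸ Submodule.mem_top (x := 1)) (0 : Fin 1)
    exact one_ne_zero (coeff_zero_one.symm.trans (mem_span_range_X_iff.1 h1))
  exact projectiveDimension_eq_of_minimal (n := 4)
    (F := fun i => ShiftedFree K σ (sixLinearFormsShifts i)) (ε := ε) F.ε_surjective
    F.exact_zero F.exact_succ hI (F.minimal 5)

end Resolution

section InvariantResolution

variable {K : Type u} [Field K] {τ : Type} {A : Subalgebra K (MvPolynomial τ K)} {m : ℕ}
  {w : Fin m → ℕ}

theorem IsMinimalHomogeneousGenerators.aeval_surjective {f : Fin m → A}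
    (hf : IsMinimalHomogeneousGenerators A w f) : Function.Surjective (aeval (R := K) f) := by
  rw [← AlgHom.range_eq_top, ← Algebra.adjoin_range_eq_range_aeval, hf.generates]

theorem IsMinimalHomogeneousGenerators.isHomogeneous_aeval {f : Fin m → A}
    (hf : IsMinimalHomogeneousGenerators A w f) (n : ℕ) (p : MvPolynomial (Fin m) K)
    (hp : IsWeightedHomogeneous w p n) : (aeval f p : MvPolynomial τ K).IsHomogeneous n := by
  rw [← Subalgebra.mvPolynomial_aeval_coe]
  exact isHomogeneous_aeval_of_isWeightedHomogeneous hf.homogeneous hp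

variable [Infinite K] {f : Fin m → linearFormsInvariants K 6}

theorem exists_skewMatrix_of_isMinimalHomogeneousGenerators (h2 : (2 : K) ≠ 0)
    (hf : IsMinimalHomogeneousGenerators (linearFormsInvariants K 6) w f) :
    ∃ x : Fin 15 → MvPolynomial (Fin m) K, (∀ k, IsWeightedHomogeneous w (x k) 2) ∧
      (∀ i, Function.Exact (pfDiff (skewMatrix x) (i + 1)) (pfDiff (skewMatrix x) i)) ∧
      ∀ r, aeval f r = 0 ↔ r ∈ pfaffianIdeal (skewMatrix x) := by
  have hA := adjoin_plucker h2
  obtain ⟨Θ, hΘ, hΘ1⟩ := exists_algEquiv_of_span_range_eq hf.linearIndependent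
    linearIndependent_plucker (hf.span_range_eq plucker_isHomogeneous hA two_ne_zero)
  let e : MvPolynomial (Fin 15) K ≃+* MvPolynomial (Fin m) K := Θ.symm.toRingEquiv
  have he : skewMatrix (e ∘ X) =
      (e : MvPolynomial (Fin 15) K →+* MvPolynomial (Fin m) K).mapMatrix (skewMatrix X) :=
    (skewMatrix_map (e : MvPolynomial (Fin 15) K →+* MvPolynomial (Fin m) K) X).symm
  refine ⟨e ∘ X, fun k => isWeightedHomogeneous_of_isHomogeneous_one
    (hf.weight_eq plucker_isHomogeneous hA two_ne_zero) (hΘ1 k), fun i => ?_, fun r => ?_⟩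
  · rw [he]
    exact (exact_pfDiff_map_ringEquiv_iff e i).2 (exact_pfDiff_generic h2 i)
  · obtain ⟨r, rfl⟩ := e.surjective r
    rw [he, map_ringEquiv_mem_pfaffianIdeal_iff, ← aeval_plucker_eq_zero_iff h2,
      ← Subalgebra.coe_eq_zero, ← Subalgebra.mvPolynomial_aeval_coe, hΘ]
    exact iff_of_eq (congrArg (aeval (plucker K) · = 0) (Θ.apply_symm_apply r))

end InvariantResolution

theorem mainTheorem3_general (K : Type u) [Field K] [Infinite K] (h2 : (2 : K) ≠ 0) :
    (∃ (m : ℕ) (w : Fin m → ℕ) (f : Fin m → linearFormsInvariants K 6),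
      IsMinimalHomogeneousGenerators (linearFormsInvariants K 6) w f) ∧
    ∀ (m : ℕ) (w : Fin m → ℕ) (f : Fin m → linearFormsInvariants K 6),
      IsMinimalHomogeneousGenerators (linearFormsInvariants K 6) w f →
      (∃ F : MinimalGradedFreeResolution w (linearFormsInvariants K 6) (aeval f)
          sixLinearFormsShifts,
        ∀ v : ShiftedFree K (Fin m) (sixLinearFormsShifts 0),
          F.ε v = aeval f (v (0 : Fin 1))) ∧
      homologicalDimension
        ((aeval f : MvPolynomial (Fin m) K →ₐ[K] linearFormsInvariants K 6) :
          MvPolynomial (Fin m) K →+* linearFormsInvariants K 6) = 6 := by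
  refine ⟨⟨15, _, _, isMinimalHomogeneousGenerators_plucker h2⟩, fun m w f hf => ?_⟩
  obtain ⟨x, hx, hexact, hker⟩ := exists_skewMatrix_of_isMinimalHomogeneousGenerators h2 hf
  have hX : ∀ i j, IsWeightedHomogeneous w (skewMatrix x i j) 2 :=
    skewMatrix_apply_mem (N := weightedHomogeneousSubmodule K w 2) hx
  let F := pfaffianResolution hf.aeval_surjective hf.isHomogeneous_aeval hX hexact hker
  exact ⟨⟨F, fun _ => rfl⟩, homologicalDimension_eq_six F⟩

theorem mainTheorem3 (K : Type u) [Field K] [CharZero K] :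
    (∃ (m : ℕ) (w : Fin m → ℕ) (f : Fin m → linearFormsInvariants K 6),
      IsMinimalHomogeneousGenerators (linearFormsInvariants K 6) w f) ∧
    ∀ (m : ℕ) (w : Fin m → ℕ) (f : Fin m → linearFormsInvariants K 6),
      IsMinimalHomogeneousGenerators (linearFormsInvariants K 6) w f →
      (∃ F : MinimalGradedFreeResolution w (linearFormsInvariants K 6) (aeval f)
          sixLinearFormsShifts,
        ∀ v : ShiftedFree K (Fin m) (sixLinearFormsShifts 0),
          F.ε v = aeval f (v (0 : Fin 1))) ∧
      homologicalDimension
        ((aeval f : MvPolynomial (Fin m) K →ₐ[K] linearFormsInvariants K 6) :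
          MvPolynomial (Fin m) K →+* linearFormsInvariants K 6) = 6 :=
  have := CharZero.infinite K
  mainTheorem3_general K two_ne_zero
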